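/- Let $\mathcal X$ be a well-nigh affine stack, that is, an algebraic stack (equivalently, a stack in groupoids for the fppf topology on the category of schemes) that admits a surjective finite locally free morphism from an affine scheme. Let $\mathrm{LF}(\mathcal X)$ be the category of locally free $\mathcal O_{\mathcal X}$-modules of finite rank, with the short exact sequences of such modules as conflations. A morphism in $\mathrm{LF}(\mathcal X)$ is an admissible monomorphism (respectively epimorphism) if it is the first (respectively second) map of a conflation; an object is projective (respectively injective) if morphisms out of it lift along all admissible epimorphisms (respectively morphisms into it extend along all admissible monomorphisms). Then $\mathrm{LF}(\mathcal X)$ is a Frobenius category: it is an exact category in the sense of Quillen, every object receives an admissible epimorphism from a projective object (enough projectives) and has an admissible monomorphism into an injective object (enough injectives), and an object is projective if and only if it is injective. Moreover, for every surjective finite locally free morphism $\pi\colon Y\to\mathcal X$ with $Y=\operatorname{Spec}A$ affine, the direct image $\pi_*P$ of the locally free $\mathcal O_Y$-module given by a finite projective $A$-module $P$ is locally free, and the projective (equivalently, injective) objects of $\mathrm{LF}(\mathcal X)$ are exactly the direct summands in $\mathrm{LF}(\mathcal X)$ of modules $\pi_*P$ with $P$ a finite projective $A$-module. -/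

import Mathlib

universe v v' u u'

open CategoryTheory CategoryTheory.Limits Opposite AlgebraicGeometry
open scoped TensorProduct

noncomputable section

namespace ExactStr

variable {C : Type u} [Category.{v} C] [Preadditive C] (E : ObjectProperty (ShortComplex C))

/-- `f` is an admissible monomorphism: the first map of a conflation. -/
def IsInflation {X Y : C} (f : X ⟶ Y) : Prop :=
  ∃ (Z : C) (g : Y ⟶ Z) (w : f ≫ g = 0), E (ShortComplex.mk f g w)

/-- `g` is an admissible epimorphism: the second map of a conflation. -/
def IsDeflation {Y Z : C} (g : Y ⟶ Z) : Prop :=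
  ∃ (X : C) (f : X ⟶ Y) (w : f ≫ g = 0), E (ShortComplex.mk f g w)

/-- The class `E` of short complexes makes the preadditive category `C` into an exact category
in the sense of Quillen: `C` is additive, and `E` is a class of kernel-cokernel pairs satisfying
Quillen's axioms. -/
structure IsExactCategory : Prop where
  hasFiniteBiproducts : HasFiniteBiproducts C
  of_iso : ∀ {S T : ShortComplex C}, (S ≅ T) → E S → E T
  isKernel : ∀ S : ShortComplex C, E S → Nonempty (IsLimit (KernelFork.ofι S.f S.zero))
  isCokernel : ∀ S : ShortComplex C, E S → Nonempty (IsColimit (CokernelCofork.ofπ S.g S.zero))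
  id_inflation : ∀ X : C, IsInflation E (𝟙 X)
  id_deflation : ∀ X : C, IsDeflation E (𝟙 X)
  comp_inflation : ∀ {X Y Z : C} (f : X ⟶ Y) (g : Y ⟶ Z),
    IsInflation E f → IsInflation E g → IsInflation E (f ≫ g)
  comp_deflation : ∀ {X Y Z : C} (f : X ⟶ Y) (g : Y ⟶ Z),
    IsDeflation E f → IsDeflation E g → IsDeflation E (f ≫ g)
  pushout_inflation : ∀ {X Y X' : C} (f : X ⟶ Y) (a : X ⟶ X'), IsInflation E f →
    ∃ (Y' : C) (b : Y ⟶ Y') (f' : X' ⟶ Y'), IsPushout f a b f' ∧ IsInflation E f'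
  pullback_deflation : ∀ {Y Z Z' : C} (g : Y ⟶ Z) (c : Z' ⟶ Z), IsDeflation E g →
    ∃ (Y' : C) (b : Y' ⟶ Y) (g' : Y' ⟶ Z'), IsPullback b g' g c ∧ IsDeflation E g'

/-- `P` is projective in the exact category `(C, E)`: morphisms out of `P` lift along every
admissible epimorphism. -/
def IsProjective (P : C) : Prop :=
  ∀ ⦃Y Z : C⦄ (g : Y ⟶ Z), IsDeflation E g → ∀ h : P ⟶ Z, ∃ l : P ⟶ Y, l ≫ g = h

/-- `I` is injective in the exact category `(C, E)`: morphisms into `I` extend along every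
admissible monomorphism. -/
def IsInjective (I : C) : Prop :=
  ∀ ⦃X Y : C⦄ (f : X ⟶ Y), IsInflation E f → ∀ h : X ⟶ I, ∃ l : Y ⟶ I, f ≫ l = h

/-- `(C, E)` is a Frobenius category: an exact category with enough projectives and enough
injectives, in which the projective and the injective objects coincide. -/
structure IsFrobeniusCategory : Prop where
  exact : IsExactCategory E
  enoughProjectives : ∀ X : C, ∃ (P : C) (g : P ⟶ X), IsProjective E P ∧ IsDeflation E g
  enoughInjectives : ∀ X : C, ∃ (I : C) (f : X ⟶ I), IsInjective E I ∧ IsInflation E f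
  projective_iff_injective : ∀ X : C, IsProjective E X ↔ IsInjective E X

end ExactStr

namespace Stk

/-- A stack in groupoids on the category of schemes for the fppf topology, given as a
pseudofunctor `T ↦ F(T)`. The associated fibered category over the category of schemes is
`Pseudofunctor.CoGrothendieck F`: its objects are the pairs `ξ = (T, x)` of a scheme `T = ξ.base`
and an object `x` of `F(T)`, i.e. (2-Yoneda) a morphism `x : T ⟶ F`. -/
structure IsFppfStackInGroupoids
    (F : Pseudofunctor (LocallyDiscrete Scheme.{u}ᵒᵖ) Cat.{v', u'}) : Prop where
  isGroupoid : ∀ T : LocallyDiscrete Scheme.{u}ᵒᵖ, IsGroupoid (F.obj T)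
  isStack : F.IsStack Scheme.fppfTopology

/-- A surjective finite locally free morphism `π : Y ⟶ F` from an affine scheme `Y`, given by
`y : F(Y)`, i.e. by the point `pt = (Y, y)`.

For a point `ξ = (T, x)`, an object over a scheme `S` of the fibre product `Y ×_F T` is given by
morphisms `a : S ⟶ Y`, `b : S ⟶ T` and an isomorphism `a^* y ≅ b^* x` in `F(S)`; equivalently, by
a point `η` over `S` together with morphisms `η ⟶ pt` and `η ⟶ ξ` in the fibered category. Hence
`Y ×_F T` is represented by a scheme `W` iff the product of `pt` and `ξ` exists in the fibered
category and lies over `W`. This is required for all `ξ`, as is that `W ⟶ T` is finite, flat,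
locally of finite presentation and surjective. The products are chosen, as one chooses fibre
products. -/
structure AffineCover (F : Pseudofunctor (LocallyDiscrete Scheme.{u}ᵒᵖ) Cat.{v', u'}) where
  /-- the affine scheme `Y` with the object `y` of `F(Y)` -/
  pt : Pseudofunctor.CoGrothendieck F
  isAffine : IsAffine pt.base
  /-- the fibre product `W = Y ×_F T`, for `ξ = (T, x)` -/
  prod (ξ : Pseudofunctor.CoGrothendieck F) : Pseudofunctor.CoGrothendieck F
  /-- the projection `W ⟶ Y` -/
  fst (ξ : Pseudofunctor.CoGrothendieck F) : prod ξ ⟶ pt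
  /-- the projection `W ⟶ T` -/
  snd (ξ : Pseudofunctor.CoGrothendieck F) : prod ξ ⟶ ξ
  isLimit (ξ : Pseudofunctor.CoGrothendieck F) : IsLimit (BinaryFan.mk (fst ξ) (snd ξ))
  isFinite (ξ : Pseudofunctor.CoGrothendieck F) : IsFinite (snd ξ).base
  flat (ξ : Pseudofunctor.CoGrothendieck F) : Flat (snd ξ).base
  locallyOfFinitePresentation (ξ : Pseudofunctor.CoGrothendieck F) :
    LocallyOfFinitePresentation (snd ξ).base
  surjective (ξ : Pseudofunctor.CoGrothendieck F) : Surjective (snd ξ).base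

/-- A well-nigh affine stack: a stack in groupoids for the fppf topology that admits a surjective
finite locally free morphism from an affine scheme. (Such a stack is automatically algebraic, with
affine diagonal, being the fppf quotient of a finite locally free groupoid of affine schemes.) -/
structure IsWellNighAffine
    (F : Pseudofunctor (LocallyDiscrete Scheme.{u}ᵒᵖ) Cat.{v', u'}) : Prop where
  isStack : IsFppfStackInGroupoids F
  exists_cover : Nonempty (AffineCover F)

variable (F : Pseudofunctor (LocallyDiscrete Scheme.{u}ᵒᵖ) Cat.{v', u'})

/-- The category of affine points of `F`: pairs `(T, x)` where `T` is an affine scheme and `x` is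
an object of `F(T)`. -/
abbrev AffPt := ObjectProperty.FullSubcategory
  (fun ξ : Pseudofunctor.CoGrothendieck F ↦ IsAffine ξ.base)

/-- The structure sheaf on affine points: `(T, x) ↦ Γ(T, 𝒪_T)`. -/
def structureSheaf : (AffPt F)ᵒᵖ ⥤ CommRingCat.{u} :=
  (ObjectProperty.ι _ ⋙ Pseudofunctor.CoGrothendieck.forget F).op ⋙ Scheme.Γ

/-- Presheaves of modules over the structure sheaf on affine points. -/
abbrev PMod := PresheafOfModules.{u} (structureSheaf F ⋙ forget₂ CommRingCat.{u} RingCat.{u})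

/-- A semilinear map `M → N` along `φ : R → S` exhibits `N` as the base change `S ⊗[R] M`. -/
def IsBaseChangeAlong {R S M N : Type u} [CommRing R] [CommRing S] [AddCommGroup M]
    [AddCommGroup N] [Module R M] [Module S N] (φ : R →+* S) (f : M →ₛₗ[φ] N) : Prop :=
  letI := φ.toAlgebra
  letI := Module.compHom N φ
  haveI : IsScalarTower R S N := ⟨fun r s n ↦ mul_smul (φ r) s n⟩
  IsBaseChange S ({ toFun := f, map_add' := f.map_add, map_smul' := f.map_smulₛₗ } : M →ₗ[R] N)

variable {F}

/-- Locally free modules of finite rank on `F`, described through their pullbacks to affine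
schemes: every affine point `(T, x)`, `T = Spec R`, gives a finite projective `R`-module (i.e. a
locally free `𝒪_T`-module of finite rank), compatibly with pullback along all morphisms of affine
points. -/
structure IsLocallyFree (M : PMod F) : Prop where
  finite (ξ : (AffPt F)ᵒᵖ) : Module.Finite ((structureSheaf F).obj ξ) (M.obj ξ)
  projective (ξ : (AffPt F)ᵒᵖ) : Module.Projective ((structureSheaf F).obj ξ) (M.obj ξ)
  baseChange {ξ ξ' : (AffPt F)ᵒᵖ} (f : ξ ⟶ ξ') :
    IsBaseChangeAlong (R := (structureSheaf F).obj ξ) (S := (structureSheaf F).obj ξ')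
      ((structureSheaf F).map f).hom (M.restrictₛₗ f)

variable (F)

/-- The category `LF(F)` of locally free modules of finite rank on the stack `F`. -/
abbrev LF := ObjectProperty.FullSubcategory (IsLocallyFree (F := F))

/-- The exact structure of `LF(F)`: the sequences of locally free modules that are short exact,
equivalently (the modules being cartesian and flat), short exact at every affine point. -/
def conflations : ObjectProperty (ShortComplex (LF F)) :=
  fun S ↦ (S.map (ObjectProperty.ι (IsLocallyFree (F := F)))).ShortExact

variable {F}

namespace AffineCover

variable (c : AffineCover F)

/-- The map `Y ×_F T' ⟶ Y ×_F T` induced by a morphism of points `(T', x') ⟶ (T, x)`. -/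
def prodMap {ξ' ξ : Pseudofunctor.CoGrothendieck F} (f : ξ' ⟶ ξ) : c.prod ξ' ⟶ c.prod ξ :=
  (c.isLimit ξ).lift (BinaryFan.mk (c.fst ξ') (c.snd ξ' ≫ f))

lemma prodMap_fst {ξ' ξ : Pseudofunctor.CoGrothendieck F} (f : ξ' ⟶ ξ) :
    c.prodMap f ≫ c.fst ξ = c.fst ξ' :=
  (c.isLimit ξ).fac (BinaryFan.mk (c.fst ξ') (c.snd ξ' ≫ f)) ⟨WalkingPair.left⟩

lemma prodMap_snd {ξ' ξ : Pseudofunctor.CoGrothendieck F} (f : ξ' ⟶ ξ) :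
    c.prodMap f ≫ c.snd ξ = c.snd ξ' ≫ f :=
  (c.isLimit ξ).fac (BinaryFan.mk (c.fst ξ') (c.snd ξ' ≫ f)) ⟨WalkingPair.right⟩

lemma prod_hom_ext {ξ η : Pseudofunctor.CoGrothendieck F} {a b : η ⟶ c.prod ξ}
    (h₁ : a ≫ c.fst ξ = b ≫ c.fst ξ) (h₂ : a ≫ c.snd ξ = b ≫ c.snd ξ) : a = b :=
  BinaryFan.IsLimit.hom_ext (c.isLimit ξ) h₁ h₂

lemma prodMap_id (ξ : Pseudofunctor.CoGrothendieck F) : c.prodMap (𝟙 ξ) = 𝟙 (c.prod ξ) :=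
  c.prod_hom_ext (by simp [prodMap_fst]) (by simp [prodMap_snd])

lemma prodMap_comp {ξ'' ξ' ξ : Pseudofunctor.CoGrothendieck F} (g : ξ'' ⟶ ξ') (f : ξ' ⟶ ξ) :
    c.prodMap (g ≫ f) = c.prodMap g ≫ c.prodMap f :=
  c.prod_hom_ext (by simp [prodMap_fst]) (by simp [prodMap_snd, reassoc_of% c.prodMap_snd g])

/-- The global functions on the scheme underlying a point. -/
abbrev Γpt (ξ : Pseudofunctor.CoGrothendieck F) : CommRingCat.{u} := Scheme.Γ.obj (op ξ.base)

/-- The pullback of global functions along a morphism of points. -/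
abbrev Γmap {ξ' ξ : Pseudofunctor.CoGrothendieck F} (f : ξ' ⟶ ξ) : Γpt ξ →+* Γpt ξ' :=
  (Scheme.Γ.map f.base.op).hom

lemma Γmap_comp {ξ'' ξ' ξ : Pseudofunctor.CoGrothendieck F} (g : ξ'' ⟶ ξ') (f : ξ' ⟶ ξ) :
    Γmap (g ≫ f) = (Γmap g).comp (Γmap f) := by
  change (Scheme.Γ.map ((g.base ≫ f.base).op)).hom = _
  rw [op_comp, Functor.map_comp, CommRingCat.hom_comp]

lemma Γmap_id (ξ : Pseudofunctor.CoGrothendieck F) : Γmap (𝟙 ξ) = RingHom.id _ := by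
  change (Scheme.Γ.map ((𝟙 ξ.base : ξ.base ⟶ ξ.base).op)).hom = _
  rw [op_id, CategoryTheory.Functor.map_id, CommRingCat.hom_id]

/-- The global functions on `W = Y ×_F T` as an algebra over those on the affine scheme `Y`. -/
instance algebraFst (ξ : Pseudofunctor.CoGrothendieck F) : Algebra (Γpt c.pt) (Γpt (c.prod ξ)) :=
  (Γmap (c.fst ξ)).toAlgebra

/-- The map on global functions induced by `Y ×_F T' ⟶ Y ×_F T`, as a map of algebras over the
global functions on `Y`. -/
def prodMapΓ {ξ' ξ : Pseudofunctor.CoGrothendieck F} (f : ξ' ⟶ ξ) :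
    Γpt (c.prod ξ) →ₐ[Γpt c.pt] Γpt (c.prod ξ') where
  toRingHom := Γmap (c.prodMap f)
  commutes' r := by
    change ((Γmap (c.prodMap f)).comp (Γmap (c.fst ξ))) r = Γmap (c.fst ξ') r
    rw [← Γmap_comp, prodMap_fst]

variable (P : Type u) [AddCommGroup P] [Module (Γpt c.pt) P]

/-- The sections of the pullback of `P` to the affine scheme `W = Y ×_F T`, i.e.
`Γ(W, 𝒪_W) ⊗ P`, the tensor product being taken over the ring of functions on `Y`. -/
def PushObj (ξ : Pseudofunctor.CoGrothendieck F) : Type u := Γpt (c.prod ξ) ⊗[Γpt c.pt] P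

instance (ξ : Pseudofunctor.CoGrothendieck F) : AddCommGroup (c.PushObj P ξ) :=
  inferInstanceAs (AddCommGroup (Γpt (c.prod ξ) ⊗[Γpt c.pt] P))

instance (ξ : Pseudofunctor.CoGrothendieck F) : Module (Γpt (c.prod ξ)) (c.PushObj P ξ) :=
  inferInstanceAs (Module (Γpt (c.prod ξ)) (Γpt (c.prod ξ) ⊗[Γpt c.pt] P))

/-- `Γ(W, 𝒪_W) ⊗ P` is a module over the functions on `T` through `W ⟶ T`. -/
@[reducible] def pushModule (ξ : Pseudofunctor.CoGrothendieck F) : Module (Γpt ξ) (c.PushObj P ξ) :=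
  Module.compHom _ (Γmap (c.snd ξ))

/-- The restriction map `Γ(W, 𝒪_W) ⊗ P → Γ(W', 𝒪_W') ⊗ P` for a morphism of points. -/
def pushMap {ξ' ξ : Pseudofunctor.CoGrothendieck F} (f : ξ' ⟶ ξ) :
    c.PushObj P ξ →+ c.PushObj P ξ' :=
  (LinearMap.rTensor P (c.prodMapΓ f).toLinearMap).toAddMonoidHom

lemma rTensor_smul {ξ' ξ : Pseudofunctor.CoGrothendieck F} (f : ξ' ⟶ ξ) (s : Γpt (c.prod ξ))
    (m : Γpt (c.prod ξ) ⊗[Γpt c.pt] P) :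
    LinearMap.rTensor P (c.prodMapΓ f).toLinearMap (s • m) =
      Γmap (c.prodMap f) s • LinearMap.rTensor P (c.prodMapΓ f).toLinearMap m := by
  induction m using TensorProduct.induction_on with
  | zero => simp only [smul_zero, map_zero]
  | tmul a p =>
    change (Γmap (c.prodMap f) (s * a) ⊗ₜ[Γpt c.pt] p : Γpt (c.prod ξ') ⊗[Γpt c.pt] P) =
      ((Γmap (c.prodMap f) s * Γmap (c.prodMap f) a) ⊗ₜ[Γpt c.pt] p :
        Γpt (c.prod ξ') ⊗[Γpt c.pt] P)
    rw [map_mul]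
  | add x y hx hy => simp only [smul_add, map_add, hx, hy]

lemma pushMap_id (ξ : Pseudofunctor.CoGrothendieck F) :
    c.pushMap P (𝟙 ξ) = AddMonoidHom.id _ := by
  have h : (c.prodMapΓ (𝟙 ξ)).toLinearMap = LinearMap.id := by
    ext a
    change Γmap (c.prodMap (𝟙 ξ)) a = a
    rw [prodMap_id, Γmap_id]
    rfl
  ext m
  change LinearMap.rTensor P (c.prodMapΓ (𝟙 ξ)).toLinearMap m = m
  rw [h, LinearMap.rTensor_id]
  rfl

lemma pushMap_comp {ξ'' ξ' ξ : Pseudofunctor.CoGrothendieck F} (g : ξ'' ⟶ ξ') (f : ξ' ⟶ ξ) :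
    c.pushMap P (g ≫ f) = (c.pushMap P g).comp (c.pushMap P f) := by
  have h : (c.prodMapΓ (g ≫ f)).toLinearMap =
      (c.prodMapΓ g).toLinearMap ∘ₗ (c.prodMapΓ f).toLinearMap := by
    ext a
    change Γmap (c.prodMap (g ≫ f)) a = Γmap (c.prodMap g) (Γmap (c.prodMap f) a)
    rw [prodMap_comp, Γmap_comp]
    rfl
  ext m
  change LinearMap.rTensor P (c.prodMapΓ (g ≫ f)).toLinearMap m =
    LinearMap.rTensor P (c.prodMapΓ g).toLinearMap (LinearMap.rTensor P (c.prodMapΓ f).toLinearMap m)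
  rw [h, LinearMap.rTensor_comp]
  rfl

lemma pushMap_smul {ξ' ξ : Pseudofunctor.CoGrothendieck F} (f : ξ' ⟶ ξ) (r : Γpt ξ)
    (m : c.PushObj P ξ) :
    letI := c.pushModule P ξ
    letI := c.pushModule P ξ'
    c.pushMap P f (r • m) = Γmap f r • c.pushMap P f m := by
  change c.pushMap P f (Γmap (c.snd ξ) r • m) =
    Γmap (c.snd ξ') (Γmap f r) • c.pushMap P f m
  have h : Γmap (c.snd ξ') (Γmap f r) = Γmap (c.prodMap f) (Γmap (c.snd ξ) r) := by
    change ((Γmap (c.snd ξ')).comp (Γmap f)) r =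
      ((Γmap (c.prodMap f)).comp (Γmap (c.snd ξ))) r
    rw [← Γmap_comp, ← Γmap_comp, prodMap_snd]
  rw [h]
  exact c.rTensor_smul P f _ m

/-- The direct image `π_* P` along `π : Y ⟶ F` of the quasi-coherent module on the affine scheme
`Y` given by a module `P` over the ring of functions on `Y`: its value at `(T, x)` is
`Γ(Y ×_F T, pr₁^* P)`, regarded as a module over the functions on `T`. -/
def pushforward : PMod F :=
  letI : ∀ ξ : (AffPt F)ᵒᵖ, Module ((structureSheaf F ⋙ forget₂ CommRingCat RingCat).obj ξ)
    (AddCommGrpCat.of (c.PushObj P ξ.unop.obj)) := fun ξ ↦ c.pushModule P ξ.unop.obj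
  PresheafOfModules.ofPresheaf
    { obj := fun ξ ↦ AddCommGrpCat.of (c.PushObj P ξ.unop.obj)
      map := fun f ↦ AddCommGrpCat.ofHom (c.pushMap P f.unop.hom)
      map_id := fun ξ ↦ by
        ext m
        exact DFunLike.congr_fun (c.pushMap_id P ξ.unop.obj) m
      map_comp := fun f g ↦ by
        ext m
        exact DFunLike.congr_fun (c.pushMap_comp P g.unop.hom f.unop.hom) m }
    (fun _ _ f r m ↦ c.pushMap_smul P f.unop.hom r m)

end AffineCover

end Stk

end

noncomputable section

/-! Write `B = π_* 𝒪_Y`, a sheaf of algebras on the affine points whose value at `ξ` is the ring of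
functions on `Y ×_F ξ`, finite projective over `O(ξ)` and compatible with base change. Everything
follows from one fact: a locally free module `N` on which `B` acts is both projective and injective,
because short exact sequences of locally free modules split over the affine scheme `Y`.

Injectivity (`CoverData.Action.exists_extension`). Given `X₁ → X₂` and `h : X₁ → N`, a retraction
over `Y` pulls back to retractions `X₂(Tξ) → X₁(Tξ)`, natural in `ξ`, where `Tξ = Y ×_F ξ`. Since
`X₁(Tξ) = B(ξ) ⊗ X₁(ξ)`, the action extends `h` to `b ⊗ x ↦ b h(x)`, and the composite `X₂(ξ) →
X₂(Tξ) → X₁(Tξ) → N(ξ)` extends `h`.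

Projectivity (`CoverData.Action.exists_lift`). Given `X₂ → X₃` and `h : N → X₃`, a section over `Y`
gives a lift `t : N(ξ) → X₂(Tξ)`, that is, an element of `N^∨ ⊗ B ⊗ X₂`. As `B` acts on the dual
`N^∨` by `(φ b)(n) = φ(b n)`, this element contracts to one of `N^∨ ⊗ X₂ = Hom(N, X₂)`, which is the
required lift. No duality theory for `π` is needed.

There are enough modules with an action. The coinduced module `Hom(B, M)` maps to `M` by evaluation
at `1`, and `M` maps to `π_* π^* M`. Over each affine point the unit of `B` has a linear retraction
`ρ : B → O` (`Module.FaithfullyFlat.exists_retraction`), so that the first map is surjective and the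
second is split injective pointwise, hence has locally free cokernel. A projective object is thus a
retract of a coinduced module and therefore injective; an injective object is a retract of a direct
image and therefore projective, and the cokernel supplies the complementary summand.

The exact structure is inherited from the abelian category of presheaves of modules, in which
locally free modules contain zero and are closed under extensions. The stack enters through its
fibres being groupoids: all arrows of the fibered category are then cartesian, so that `B` is
compatible with base change (`AffineCover.isPullback_base`). -/

/-- The short five lemma. -/
lemma bijective_of_shortExact {A' A A'' B' B B'' : Type*} [AddCommGroup A'] [AddCommGroup A]
    [AddCommGroup A''] [AddCommGroup B'] [AddCommGroup B] [AddCommGroup B'']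
    (i : A' →+ A) (p : A →+ A'') (j : B' →+ B) (q : B →+ B'')
    {c' : A' →+ B'} {c : A →+ B} {c'' : A'' →+ B''}
    (hij : ∀ x, j (c' x) = c (i x)) (hpq : ∀ x, q (c x) = c'' (p x))
    (hip : Function.Exact i p) (hp : Function.Surjective p)
    (hj : Function.Injective j) (hjq : Function.Exact j q)
    (h' : Function.Bijective c') (h'' : Function.Bijective c'') : Function.Bijective c := by
  refine ⟨(injective_iff_map_eq_zero c).2 fun x hx ↦ ?_, fun y ↦ ?_⟩
  · have : p x = 0 := h''.1 (by rw [← hpq, hx, map_zero, map_zero])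
    obtain ⟨a, rfl⟩ := (hip x).1 this
    have : c' a = 0 := hj (by rw [hij, hx, map_zero])
    rw [h'.1 (this.trans (map_zero c').symm), map_zero]
  · obtain ⟨z, hz⟩ := h''.2 (q y)
    obtain ⟨x, rfl⟩ := hp z
    obtain ⟨b, hb⟩ := (hjq (y - c x)).1 (by rw [map_sub, hpq, hz, sub_self])
    obtain ⟨a, rfl⟩ := h'.2 b
    exact ⟨i a + x, by rw [map_add, ← hij, hb, sub_add_cancel]⟩

/-! ### Base change of modules along a ring homomorphism. -/

namespace Stk.IsBaseChangeAlong

variable {R S M N : Type u} [CommRing R] [CommRing S] [AddCommGroup M]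
  [AddCommGroup N] [Module R M] [Module S N] {φ : R →+* S} {f : M →ₛₗ[φ] N}

/-- A balanced biadditive map on `S × M` factors through the base change. -/
lemma exists_lift (h : IsBaseChangeAlong φ f) {Q : Type*} [AddCommGroup Q] (g : S →+ M →+ Q)
    (hg : ∀ s r m, g (s * φ r) m = g s (r • m)) :
    ∃ k : N →+ Q, ∀ s m, k (s • f m) = g s m := by
  let := φ.toAlgebra
  let := Module.compHom N φ
  have : IsScalarTower R S N := ⟨fun r s n ↦ mul_smul (φ r) s n⟩
  let f' : M →ₗ[R] N := { toFun := f, map_add' := f.map_add, map_smul' := f.map_smulₛₗ }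
  have h' : IsBaseChange S f' := h
  let t : S ⊗[R] M →+ Q := TensorProduct.liftAddHom g fun r s m ↦ by
    rw [← hg, mul_comm]; rfl
  refine ⟨t.comp h'.equiv.symm.toLinearMap.toAddMonoidHom, fun s m ↦ ?_⟩
  change t (h'.equiv.symm (s • f' m)) = _
  rw [map_smul, h'.equiv_symm_apply, TensorProduct.smul_tmul', smul_eq_mul, mul_one]
  rfl

-- The elements `s • f m` generate the base change additively. Later identities between additive
-- maps out of a base change are all checked on these generators.
@[elab_as_elim]
lemma induction (h : IsBaseChangeAlong φ f) {motive : N → Prop} (zero : motive 0)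
    (add : ∀ a b, motive a → motive b → motive (a + b))
    (smul : ∀ (s : S) m, motive (s • f m)) (n : N) : motive n := by
  let := φ.toAlgebra
  let := Module.compHom N φ
  have : IsScalarTower R S N := ⟨fun r s n ↦ mul_smul (φ r) s n⟩
  let f' : M →ₗ[R] N := { toFun := f, map_add' := f.map_add, map_smul' := f.map_smulₛₗ }
  have h' : IsBaseChange S f' := h
  obtain ⟨t, rfl⟩ := h'.equiv.surjective n
  induction t using TensorProduct.induction_on with
  | zero => simpa using zero
  | tmul s m => rw [h'.equiv_tmul]; exact smul s m
  | add a b ha hb => simpa using add _ _ ha hb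

lemma addHom_ext (h : IsBaseChangeAlong φ f) {Q : Type*} [AddCommGroup Q] {k k' : N →+ Q}
    (hk : ∀ (s : S) m, k (s • f m) = k' (s • f m)) : k = k' := by
  ext n
  exact h.induction (by simp) (fun a b ha hb ↦ by simp [ha, hb]) hk n

/-- Semilinear maps extend uniquely to linear maps on the base change. -/
lemma exists_lift_linear (h : IsBaseChangeAlong φ f) {Q : Type*} [AddCommGroup Q] [Module S Q]
    (g : M →ₛₗ[φ] Q) : ∃ k : N →ₗ[S] Q, ∀ m, k (f m) = g m := by
  obtain ⟨k, hk⟩ := h.exists_lift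
    (AddMonoidHom.mk' (fun s : S ↦ AddMonoidHom.mk' (fun m : M ↦ s • g m)
      (fun a b ↦ by simp)) (fun a b ↦ by ext; simp [add_smul]))
    (fun s r m ↦ by simp [mul_smul])
  have hk' : ∀ s m, k (s • f m) = s • g m := hk
  refine ⟨{ k with map_smul' := fun s n ↦ ?_ }, fun m ↦ by simpa using hk' 1 m⟩
  change k (s • n) = s • k n
  exact h.induction (by simp) (fun a b ha hb ↦ by simp [ha, hb])
    (fun t m ↦ by rw [smul_smul, hk', hk', mul_smul]) n

lemma linear_ext (h : IsBaseChangeAlong φ f) {Q : Type*} [AddCommGroup Q] [Module S Q]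
    {k k' : N →ₗ[S] Q} (hk : ∀ m, k (f m) = k' (f m)) : k = k' := by
  ext n
  exact h.induction (by simp) (fun a b ha hb ↦ by simp [ha, hb]) (fun s m ↦ by simp [hk]) n

/-- A semilinear map whose image spans is a base change as soon as the canonical map from the
tensor product has a left inverse. -/
lemma of_leftInverse (hspan : ∀ n : N, n ∈ Submodule.span S (Set.range f))
    (h : letI := φ.toAlgebra
      ∃ t : N →+ S ⊗[R] M, ∀ s m, t (s • f m) = s ⊗ₜ m) : IsBaseChangeAlong φ f := by
  let := φ.toAlgebra
  let := Module.compHom N φ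
  have : IsScalarTower R S N := ⟨fun r s n ↦ mul_smul (φ r) s n⟩
  let f' : M →ₗ[R] N := { toFun := f, map_add' := f.map_add, map_smul' := f.map_smulₛₗ }
  obtain ⟨t, ht⟩ := h
  let l : S ⊗[R] M →ₗ[S] N := f'.liftBaseChange S
  have hl : ∀ s m, l (s ⊗ₜ m) = s • f m := fun s m ↦ by simp [l]; rfl
  have htl : ∀ x, t (l x) = x := fun x ↦ by
    induction x using TensorProduct.induction_on with
    | zero => simp
    | tmul s m => rw [hl, ht]
    | add a b ha hb => rw [map_add, map_add, ha, hb]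
  have hsurj : Function.Surjective l := fun n ↦ by
    have : Submodule.span S (Set.range f) ≤ LinearMap.range l := by
      rw [Submodule.span_le]
      rintro _ ⟨m, rfl⟩
      exact ⟨1 ⊗ₜ m, by simp [hl]⟩
    exact this (hspan n)
  change IsBaseChange S f'
  exact IsBaseChange.of_equiv (LinearEquiv.ofBijective l ⟨Function.LeftInverse.injective htl, hsurj⟩)
    fun x ↦ by change l (1 ⊗ₜ x) = _; rw [hl, one_smul]; rfl

section ShortExact

variable {M' M'' N' N'' : Type u} [AddCommGroup M'] [AddCommGroup M''] [AddCommGroup N']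
  [AddCommGroup N''] [Module R M'] [Module R M''] [Module S N'] [Module S N'']
  {f' : M' →ₛₗ[φ] N'} {f'' : M'' →ₛₗ[φ] N''}
  {i : M' →ₗ[R] M} {p : M →ₗ[R] M''} {j : N' →ₗ[S] N} {q : N →ₗ[S] N''}

/-- Compare the tensored sequence with the second one. The only delicate point is that `i` stays
injective after tensoring; this holds because `M''` is projective, so that `i` has a retraction. -/
lemma of_shortExact_left (hi : Function.Injective i) (hip : Function.Exact i p)
    (hp : Function.Surjective p) [Module.Projective R M'']
    (hj : Function.Injective j) (hjq : Function.Exact j q)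
    (hij : ∀ m, j (f' m) = f (i m)) (hpq : ∀ m, q (f m) = f'' (p m))
    (h : IsBaseChangeAlong φ f) (h'' : IsBaseChangeAlong φ f'') : IsBaseChangeAlong φ f' := by
  let := φ.toAlgebra
  let := Module.compHom N φ
  have : IsScalarTower R S N := ⟨fun r s n ↦ mul_smul (φ r) s n⟩
  let := Module.compHom N' φ
  have : IsScalarTower R S N' := ⟨fun r s n ↦ mul_smul (φ r) s n⟩
  let := Module.compHom N'' φ
  have : IsScalarTower R S N'' := ⟨fun r s n ↦ mul_smul (φ r) s n⟩
  let g : M →ₗ[R] N := { toFun := f, map_add' := f.map_add, map_smul' := f.map_smulₛₗ }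
  let g' : M' →ₗ[R] N' := { toFun := f', map_add' := f'.map_add, map_smul' := f'.map_smulₛₗ }
  let g'' : M'' →ₗ[R] N'' :=
    { toFun := f'', map_add' := f''.map_add, map_smul' := f''.map_smulₛₗ }
  change IsBaseChange S g'
  replace h : IsBaseChange S g := h
  replace h'' : IsBaseChange S g'' := h''
  have comm₁ : g.comp i = (j.restrictScalars R).comp g' := LinearMap.ext fun m ↦ (hij m).symm
  have comm₂ : g''.comp p = (q.restrictScalars R).comp g := LinearMap.ext fun m ↦ (hpq m).symm
  simp only [IsBaseChange, IsTensorProduct] at h h'' ⊢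
  refine LinearMap.bijective_of_bijective_of_injective_of_left_exact
    ((i.baseChange S).restrictScalars R) ((p.baseChange S).restrictScalars R)
    (j.restrictScalars R) (q.restrictScalars R) _ _ _ ?_ ?_ ?_ hjq h h''.1 ?_ hj
  · ext s m
    simpa using congr(s • ($comm₁ m)).symm
  · ext s m
    simpa using congr(s • ($comm₂ m)).symm
  · exact lTensor_exact S hip hp
  · obtain ⟨s, hs⟩ := Module.projective_lifting_property p LinearMap.id hp
    have ⟨_, t, ht⟩ := ((Function.Exact.split_tfae' hip).out 0 1 :
      (Function.Injective i ∧ ∃ l, p ∘ₗ l = LinearMap.id) ↔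
        (Function.Surjective p ∧ ∃ l, l ∘ₗ i = LinearMap.id)).1 ⟨hi, s, hs⟩
    have : (t.baseChange S) ∘ₗ (i.baseChange S) = LinearMap.id := by
      rw [← LinearMap.baseChange_comp, ht, LinearMap.baseChange_id]
    exact Function.LeftInverse.injective (g := t.baseChange S) fun x ↦ congr($this x)

lemma of_shortExact_right (hip : Function.Exact i p) (hp : Function.Surjective p)
    (hjq : Function.Exact j q) (hq : Function.Surjective q)
    (hij : ∀ m, j (f' m) = f (i m)) (hpq : ∀ m, q (f m) = f'' (p m))
    (h' : IsBaseChangeAlong φ f') (h : IsBaseChangeAlong φ f) : IsBaseChangeAlong φ f'' := by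
  let := φ.toAlgebra
  let := Module.compHom N φ
  have : IsScalarTower R S N := ⟨fun r s n ↦ mul_smul (φ r) s n⟩
  let := Module.compHom N' φ
  have : IsScalarTower R S N' := ⟨fun r s n ↦ mul_smul (φ r) s n⟩
  let := Module.compHom N'' φ
  have : IsScalarTower R S N'' := ⟨fun r s n ↦ mul_smul (φ r) s n⟩
  let g : M →ₗ[R] N := { toFun := f, map_add' := f.map_add, map_smul' := f.map_smulₛₗ }
  let g' : M' →ₗ[R] N' := { toFun := f', map_add' := f'.map_add, map_smul' := f'.map_smulₛₗ }
  let g'' : M'' →ₗ[R] N'' :=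
    { toFun := f'', map_add' := f''.map_add, map_smul' := f''.map_smulₛₗ }
  exact IsBaseChange.of_right_exact S g' g g'' (f := i) (g := p) (f' := j) (g' := q)
    (LinearMap.ext fun m ↦ (hij m).symm)
    (LinearMap.ext fun m ↦ (hpq m).symm) h' h hip hp hjq hq

/-- The short five lemma, in a form that does not ask for injectivity in the tensored row: right
exactness of the tensor product is enough. -/
lemma of_shortExact_middle (hip : Function.Exact i p) (hp : Function.Surjective p)
    (hj : Function.Injective j) (hjq : Function.Exact j q)
    (hij : ∀ m, j (f' m) = f (i m)) (hpq : ∀ m, q (f m) = f'' (p m))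
    (h' : IsBaseChangeAlong φ f') (h'' : IsBaseChangeAlong φ f'') : IsBaseChangeAlong φ f := by
  let := φ.toAlgebra
  let := Module.compHom N φ
  have : IsScalarTower R S N := ⟨fun r s n ↦ mul_smul (φ r) s n⟩
  let := Module.compHom N' φ
  have : IsScalarTower R S N' := ⟨fun r s n ↦ mul_smul (φ r) s n⟩
  let := Module.compHom N'' φ
  have : IsScalarTower R S N'' := ⟨fun r s n ↦ mul_smul (φ r) s n⟩
  let g : M →ₗ[R] N := { toFun := f, map_add' := f.map_add, map_smul' := f.map_smulₛₗ }
  let g' : M' →ₗ[R] N' := { toFun := f', map_add' := f'.map_add, map_smul' := f'.map_smulₛₗ }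
  let g'' : M'' →ₗ[R] N'' :=
    { toFun := f'', map_add' := f''.map_add, map_smul' := f''.map_smulₛₗ }
  change IsBaseChange S g
  replace h' : IsBaseChange S g' := h'
  replace h'' : IsBaseChange S g'' := h''
  have comm₁ : g.comp i = (j.restrictScalars R).comp g' := LinearMap.ext fun m ↦ (hij m).symm
  have comm₂ : g''.comp p = (q.restrictScalars R).comp g := LinearMap.ext fun m ↦ (hpq m).symm
  simp only [IsBaseChange, IsTensorProduct] at h' h'' ⊢
  refine bijective_of_shortExact (i.baseChange S).toAddMonoidHom (p.baseChange S).toAddMonoidHom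
    j.toAddMonoidHom q.toAddMonoidHom (c' := (TensorProduct.lift _).toAddMonoidHom)
    (c := (TensorProduct.lift _).toAddMonoidHom) (c'' := (TensorProduct.lift _).toAddMonoidHom)
    (fun x ↦ ?_) (fun x ↦ ?_) (lTensor_exact S hip hp) (LinearMap.lTensor_surjective S hp)
    hj hjq h' h''
  · induction x using TensorProduct.induction_on with
    | zero => simp
    | tmul s m => simpa using congr(s • ($comm₁ m)).symm
    | add a b ha hb => simpa using congr($ha + $hb)
  · induction x using TensorProduct.induction_on with
    | zero => simp
    | tmul s m => simpa using congr(s • ($comm₂ m)).symm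
    | add a b ha hb => simpa using congr($ha + $hb)

end ShortExact

end Stk.IsBaseChangeAlong

/-! ### Exact structures on extension-closed subcategories of abelian categories. -/

namespace ExactStr

variable {A : Type*} [Category* A] [Abelian A] (P : ObjectProperty A)

/-- The short complexes in a full subcategory of an abelian category that become short exact in
the abelian category. -/
abbrev shortExactIn : ObjectProperty (ShortComplex P.FullSubcategory) :=
  fun S ↦ (S.map P.ι).ShortExact

lemma shortExact_cokernel {X Y : A} (f : X ⟶ Y) [Mono f] :
    (ShortComplex.mk f (cokernel.π f) (cokernel.condition f)).ShortExact where
  exact := ShortComplex.exact_cokernel f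

lemma shortExact_kernel {Y Z : A} (g : Y ⟶ Z) [Epi g] :
    (ShortComplex.mk (kernel.ι g) g (kernel.condition g)).ShortExact where
  exact := ShortComplex.exact_kernel g

variable {P}

/-- Since `ker g = 0`, the kernel-cokernel sequence of the composite exhibits `coker (f ≫ g)` as an
extension of `coker g` by `coker f`. -/
lemma prop_cokernel_comp [P.IsClosedUnderExtensions] {X Y Z : A} (f : X ⟶ Y) (g : Y ⟶ Z) [Mono g]
    (hf : P (cokernel f)) (hg : P (cokernel g)) : P (cokernel (f ≫ g)) := by
  have h₂ := (kernelCokernelCompSequence_exact f g).exact 2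
  have h₃ := (kernelCokernelCompSequence_exact f g).exact 3
  have : Mono (cokernel.map f (f ≫ g) (𝟙 _) g (by simp)) :=
    h₂.mono_g ((isZero_kernel_of_mono g).eq_of_src _ _)
  exact P.prop_X₂_of_shortExact (ShortComplex.ShortExact.mk' h₃ this
    (inferInstanceAs (Epi (cokernel.map (f ≫ g) g f (𝟙 _) (by simp))))) hf hg

lemma prop_kernel_comp [P.IsClosedUnderExtensions] {X Y Z : A} (f : X ⟶ Y) (g : Y ⟶ Z) [Epi f]
    (hf : P (kernel f)) (hg : P (kernel g)) : P (kernel (f ≫ g)) := by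
  have h₀ := (kernelCokernelCompSequence_exact f g).exact 0
  have h₁ := (kernelCokernelCompSequence_exact f g).exact 1
  have : Epi (kernel.map (f ≫ g) g f (𝟙 _) (by simp)) :=
    h₁.epi_f ((isZero_cokernel_of_epi f).eq_of_tgt _ _)
  exact P.prop_X₂_of_shortExact (ShortComplex.ShortExact.mk' h₀
    (inferInstanceAs (Mono (kernel.map f (f ≫ g) (𝟙 _) g (by simp)))) this) hf hg

variable [P.IsClosedUnderIsomorphisms]

/-- This turns admissibility into a condition in the ambient abelian category, where Quillen's
axioms become statements about kernels and cokernels. -/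
lemma isInflation_iff {X Y : P.FullSubcategory} (f : X ⟶ Y) :
    IsInflation (shortExactIn P) f ↔ Mono f.hom ∧ P (cokernel f.hom) := by
  constructor
  · rintro ⟨Z, g, w, h⟩
    have hm : Mono f.hom := h.mono_f
    exact ⟨hm, P.prop_of_iso (h.gIsCokernel.coconePointUniqueUpToIso
      (colimit.isColimit _)) Z.property⟩
  · rintro ⟨hm, hP⟩
    exact ⟨⟨cokernel f.hom, hP⟩, P.homMk (cokernel.π f.hom),
      by ext; exact cokernel.condition f.hom, shortExact_cokernel f.hom⟩

lemma isDeflation_iff {Y Z : P.FullSubcategory} (g : Y ⟶ Z) :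
    IsDeflation (shortExactIn P) g ↔ Epi g.hom ∧ P (kernel g.hom) := by
  constructor
  · rintro ⟨X, f, w, h⟩
    have hm : Epi g.hom := h.epi_g
    exact ⟨hm, P.prop_of_iso (h.fIsKernel.conePointUniqueUpToIso
      (limit.isLimit _)) X.property⟩
  · rintro ⟨hm, hP⟩
    exact ⟨⟨kernel g.hom, hP⟩, P.homMk (kernel.ι g.hom),
      by ext; exact kernel.condition g.hom, shortExact_kernel g.hom⟩

/-- A full subcategory of an abelian category that contains zero and is closed under extensions
is an exact category. -/
theorem isExactCategory_shortExactIn [P.ContainsZero] [P.IsClosedUnderExtensions] :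
    IsExactCategory (shortExactIn P) where
  hasFiniteBiproducts := by
    have : P.IsClosedUnderBinaryProducts := .mk' (by
      rintro _ ⟨F, hF⟩
      have e : limit F ≅ F.obj ⟨.left⟩ ⊞ F.obj ⟨.right⟩ :=
        (HasLimit.isoOfNatIso (diagramIsoPair F)) ≪≫ (biprod.isoProd _ _).symm
      exact P.prop_of_iso e.symm (P.prop_biprod (hF _) (hF _)))
    have : P.IsClosedUnderFiniteProducts := .mk'
    have : HasFiniteProducts P.FullSubcategory := ⟨fun n ↦ inferInstance⟩
    exact HasFiniteBiproducts.of_hasFiniteProducts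
  of_iso e h := ShortComplex.shortExact_of_iso (P.ι.mapShortComplex.mapIso e) h
  isKernel S h := ⟨isLimitOfReflects P.ι
    ((isLimitMapConeForkEquiv' P.ι S.zero).symm h.fIsKernel)⟩
  isCokernel S h := ⟨isColimitOfReflects P.ι
    ((isColimitMapCoconeCoforkEquiv' P.ι S.zero).symm h.gIsCokernel)⟩
  id_inflation X := (isInflation_iff _).2 ⟨inferInstanceAs (Mono (𝟙 X.obj)),
    P.prop_of_isZero (isZero_cokernel_of_epi (𝟙 X.obj))⟩
  id_deflation X := (isDeflation_iff _).2 ⟨inferInstanceAs (Epi (𝟙 X.obj)),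
    P.prop_of_isZero (isZero_kernel_of_mono (𝟙 X.obj))⟩
  comp_inflation f g hf hg := by
    rw [isInflation_iff] at *
    have := hf.1
    have := hg.1
    exact ⟨inferInstanceAs (Mono (f.hom ≫ g.hom)), prop_cokernel_comp f.hom g.hom hf.2 hg.2⟩
  comp_deflation f g hf hg := by
    rw [isDeflation_iff] at *
    have := hf.1
    have := hg.1
    exact ⟨inferInstanceAs (Epi (f.hom ≫ g.hom)), prop_kernel_comp f.hom g.hom hf.2 hg.2⟩
  pushout_inflation {X Y X'} f a hf := by
    rw [isInflation_iff] at hf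
    have := hf.1
    have sq := IsPushout.of_hasPushout f.hom a.hom
    have := isIso_cokernel_map_of_isPushout sq
    -- Opposite sides of a pushout square have the same cokernel, so the pushout is an extension of
    -- that cokernel by `X'` and stays in the subcategory.
    have hc : P (cokernel (pushout.inr f.hom a.hom)) :=
      P.prop_of_iso (asIso (cokernel.map _ _ _ _ sq.w)) hf.2
    let Y' : P.FullSubcategory := ⟨pushout f.hom a.hom, P.prop_X₂_of_shortExact
      (shortExact_cokernel (pushout.inr f.hom a.hom)) X'.property hc⟩
    refine ⟨Y', P.homMk (pushout.inl f.hom a.hom), P.homMk (pushout.inr f.hom a.hom), ?_, ?_⟩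
    · exact IsPushout.of_map P.ι (by ext; exact sq.w) sq
    · exact (isInflation_iff _).2 ⟨inferInstanceAs (Mono (pushout.inr f.hom a.hom)), hc⟩
  pullback_deflation {Y Z Z'} g c hg := by
    rw [isDeflation_iff] at hg
    have := hg.1
    have sq := (IsPullback.of_hasPullback g.hom c.hom)
    have := isIso_kernel_map_of_isPullback sq.flip
    have hc : P (kernel (pullback.snd g.hom c.hom)) :=
      P.prop_of_iso (asIso (kernel.map _ _ _ _ sq.flip.w)).symm hg.2
    let Y' : P.FullSubcategory := ⟨pullback g.hom c.hom, P.prop_X₂_of_shortExact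
      (shortExact_kernel (pullback.snd g.hom c.hom)) hc Z'.property⟩
    refine ⟨Y', P.homMk (pullback.fst g.hom c.hom), P.homMk (pullback.snd g.hom c.hom), ?_, ?_⟩
    · exact IsPullback.of_map P.ι (by ext; exact sq.w) sq
    · exact (isDeflation_iff _).2 ⟨inferInstanceAs (Epi (pullback.snd g.hom c.hom)), hc⟩

end ExactStr

/-! ### Presheaves of modules and locally free modules. -/

namespace Stk

variable {C : Type*} [Category* C] {O : Cᵒᵖ ⥤ CommRingCat.{u}}

variable (O) in
/-- Presheaves of modules over a presheaf of commutative rings. -/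
abbrev OMod := PresheafOfModules.{u} (O ⋙ forget₂ CommRingCat.{u} RingCat.{u})

namespace OMod

/-- The restriction maps of a presheaf of modules, as semilinear maps. -/
def res (M : OMod O) {ξ ξ' : Cᵒᵖ} (f : ξ ⟶ ξ') : M.obj ξ →ₛₗ[(O.map f).hom] M.obj ξ' :=
  M.restrictₛₗ f

lemma res_id (M : OMod O) {ξ : Cᵒᵖ} (x : M.obj ξ) : M.res (𝟙 ξ) x = x :=
  ConcreteCategory.congr_hom (M.presheaf.map_id ξ) x

lemma res_comp (M : OMod O) {ξ ξ' ξ'' : Cᵒᵖ} (f : ξ ⟶ ξ') (g : ξ' ⟶ ξ'') (x : M.obj ξ) :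
    M.res (f ≫ g) x = M.res g (M.res f x) :=
  ConcreteCategory.congr_hom (M.presheaf.map_comp f g) x

lemma res_congr (M : OMod O) {ξ ξ' : Cᵒᵖ} {f g : ξ ⟶ ξ'} (h : f = g) (x : M.obj ξ) :
    M.res f x = M.res g x := by rw [h]

lemma res_smul (M : OMod O) {ξ ξ' : Cᵒᵖ} (f : ξ ⟶ ξ') (r : O.obj ξ) (x : M.obj ξ) :
    M.res f (r • x) = (O.map f).hom r • M.res f x := (M.res f).map_smulₛₗ r x

/-- The components of a morphism of presheaves of modules, as linear maps. -/
def appₗ {M N : OMod O} (h : M ⟶ N) (ξ : Cᵒᵖ) : M.obj ξ →ₗ[O.obj ξ] N.obj ξ := (h.app ξ).hom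

lemma appₗ_res {M N : OMod O} (h : M ⟶ N) {ξ ξ' : Cᵒᵖ} (f : ξ ⟶ ξ') (x : M.obj ξ) :
    appₗ h ξ' (M.res f x) = N.res f (appₗ h ξ x) :=
  PresheafOfModules.naturality_apply h f x

lemma hom_ext {M N : OMod O} {h k : M ⟶ N} (w : ∀ ξ x, appₗ h ξ x = appₗ k ξ x) : h = k :=
  PresheafOfModules.hom_ext fun ξ ↦ ModuleCat.hom_ext (LinearMap.ext (w ξ))

/-- Morphisms of presheaves of modules from natural families of linear maps. -/
def homOfNatural {M N : OMod O} (h : ∀ ξ, M.obj ξ →ₗ[O.obj ξ] N.obj ξ)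
    (w : ∀ {ξ ξ' : Cᵒᵖ} (f : ξ ⟶ ξ') x, h ξ' (M.res f x) = N.res f (h ξ x)) : M ⟶ N where
  app ξ := ModuleCat.ofHom (h ξ)
  naturality f := by
    ext x
    exact w f x

/-- Presheaves of modules from families of modules with semilinear restriction maps. -/
def ofFamily (M : Cᵒᵖ → Type u) [∀ ξ, AddCommGroup (M ξ)] [∀ ξ, Module (O.obj ξ) (M ξ)]
    (r : ∀ {ξ ξ' : Cᵒᵖ} (f : ξ ⟶ ξ'), M ξ →ₛₗ[(O.map f).hom] M ξ')
    (r_id : ∀ ξ (x : M ξ), r (𝟙 ξ) x = x)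
    (r_comp : ∀ {ξ ξ' ξ'' : Cᵒᵖ} (f : ξ ⟶ ξ') (g : ξ' ⟶ ξ'') (x : M ξ),
      r (f ≫ g) x = r g (r f x)) : OMod O :=
  letI : ∀ ξ, Module ((O ⋙ forget₂ CommRingCat RingCat).obj ξ) (AddCommGrpCat.of (M ξ)) :=
    fun ξ ↦ inferInstanceAs (Module (O.obj ξ) (M ξ))
  PresheafOfModules.ofPresheaf
    { obj := fun ξ ↦ AddCommGrpCat.of (M ξ)
      map := fun f ↦ AddCommGrpCat.ofHom (r f).toAddMonoidHom
      map_id := fun ξ ↦ by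
        ext m
        exact r_id ξ m
      map_comp := fun f g ↦ by
        ext m
        exact r_comp f g m }
    (fun _ _ f a m ↦ (r f).map_smulₛₗ a m)

lemma injective_appₗ {S : ShortComplex (OMod O)} (h : S.ShortExact) (ξ : Cᵒᵖ) :
    Function.Injective (appₗ S.f ξ) :=
  have := h.mono_f
  PresheafOfModules.injective_of_mono S.f ξ

lemma surjective_appₗ {S : ShortComplex (OMod O)} (h : S.ShortExact) (ξ : Cᵒᵖ) :
    Function.Surjective (appₗ S.g ξ) :=
  have := h.epi_g
  PresheafOfModules.surjective_of_epi S.g ξ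

lemma exact_appₗ {S : ShortComplex (OMod O)} (h : S.ShortExact) (ξ : Cᵒᵖ) :
    Function.Exact (appₗ S.f ξ) (appₗ S.g ξ) := by
  have := h.mono_f
  have := h.epi_g
  have h' := (h.map (PresheafOfModules.evaluation _ ξ)).exact
  exact (ShortComplex.ShortExact.moduleCat_exact_iff_function_exact _).1 h'

end OMod

open OMod

/-- Locally free modules of finite rank over a presheaf of commutative rings. -/
structure IsLocFree (M : OMod O) : Prop where
  finite (ξ : Cᵒᵖ) : Module.Finite (O.obj ξ) (M.obj ξ)
  projective (ξ : Cᵒᵖ) : Module.Projective (O.obj ξ) (M.obj ξ)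
  baseChange {ξ ξ' : Cᵒᵖ} (f : ξ ⟶ ξ') : IsBaseChangeAlong (O.map f).hom (M.res f)

namespace IsLocFree

variable {S : ShortComplex (OMod O)}

/-- The splitting is obtained at each object separately, with no naturality in `ξ`. -/
lemma exists_section (h : S.ShortExact) (h₃ : IsLocFree S.X₃) (ξ : Cᵒᵖ) :
    ∃ l, appₗ S.g ξ ∘ₗ l = LinearMap.id :=
  have := h₃.projective ξ
  Module.projective_lifting_property (appₗ S.g ξ) LinearMap.id (surjective_appₗ h ξ)

lemma exists_retraction (h : S.ShortExact) (h₃ : IsLocFree S.X₃) (ξ : Cᵒᵖ) :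
    ∃ l, l ∘ₗ appₗ S.f ξ = LinearMap.id :=
  (((Function.Exact.split_tfae' (exact_appₗ h ξ)).out 0 1 :
    (Function.Injective (appₗ S.f ξ) ∧ ∃ l, appₗ S.g ξ ∘ₗ l = LinearMap.id) ↔
      (Function.Surjective (appₗ S.g ξ) ∧ ∃ l, l ∘ₗ appₗ S.f ξ = LinearMap.id)).1
        ⟨injective_appₗ h ξ, exists_section h h₃ ξ⟩).2

/-- Kernels of epimorphisms of locally free modules are locally free. -/
lemma X₁ (h : S.ShortExact) (h₂ : IsLocFree S.X₂) (h₃ : IsLocFree S.X₃) : IsLocFree S.X₁ := by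
  have key := exists_retraction h h₃
  refine ⟨fun ξ ↦ ?_, fun ξ ↦ ?_, fun {ξ ξ'} f ↦ ?_⟩
  · obtain ⟨l, hl⟩ := key ξ
    have := h₂.finite ξ
    exact Module.Finite.of_surjective l (LinearMap.surjective_of_comp_eq_id _ _ hl)
  · obtain ⟨l, hl⟩ := key ξ
    have := h₂.projective ξ
    exact Module.Projective.of_split _ l hl
  · have := h₃.projective ξ
    exact .of_shortExact_left (injective_appₗ h ξ) (exact_appₗ h ξ) (surjective_appₗ h ξ)
      (injective_appₗ h ξ') (exact_appₗ h ξ') (appₗ_res S.f f) (appₗ_res S.g f)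
      (h₂.baseChange f) (h₃.baseChange f)

/-- Extensions of locally free modules are locally free. -/
lemma X₂ (h : S.ShortExact) (h₁ : IsLocFree S.X₁) (h₃ : IsLocFree S.X₃) : IsLocFree S.X₂ := by
  refine ⟨fun ξ ↦ ?_, fun ξ ↦ ?_, fun {ξ ξ'} f ↦ ?_⟩
  · have := h₁.finite ξ
    have := h₃.finite ξ
    exact Module.Finite.of_exact (exact_appₗ h ξ) (surjective_appₗ h ξ)
  · have := h₁.projective ξ
    have := h₃.projective ξ
    obtain ⟨s, hs⟩ := exists_section h h₃ ξ
    have ⟨e, _⟩ := ((exact_appₗ h ξ).splitSurjectiveEquiv (injective_appₗ h ξ)) ⟨s, hs⟩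
    exact Module.Projective.of_equiv e.symm
  · exact .of_shortExact_middle (exact_appₗ h ξ) (surjective_appₗ h ξ)
      (injective_appₗ h ξ') (exact_appₗ h ξ') (appₗ_res S.f f) (appₗ_res S.g f)
      (h₁.baseChange f) (h₃.baseChange f)

/-- A quotient of locally free modules is locally free if its values are projective. -/
lemma X₃ (h : S.ShortExact) (h₁ : IsLocFree S.X₁) (h₂ : IsLocFree S.X₂)
    (h₃ : ∀ ξ, Module.Projective (O.obj ξ) (S.X₃.obj ξ)) : IsLocFree S.X₃ := by
  refine ⟨fun ξ ↦ ?_, h₃, fun {ξ ξ'} f ↦ ?_⟩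
  · have := h₂.finite ξ
    exact Module.Finite.of_surjective (appₗ S.g ξ) (surjective_appₗ h ξ)
  · exact .of_shortExact_right (exact_appₗ h ξ) (surjective_appₗ h ξ)
      (exact_appₗ h ξ') (surjective_appₗ h ξ') (appₗ_res S.f f) (appₗ_res S.g f)
      (h₁.baseChange f) (h₂.baseChange f)

lemma of_isZero {M : OMod O} (h : IsZero M) : IsLocFree M := by
  have (ξ : Cᵒᵖ) : Subsingleton (M.obj ξ) :=
    ModuleCat.subsingleton_of_isZero ((PresheafOfModules.evaluation _ ξ).map_isZero h)
  refine ⟨fun ξ ↦ inferInstance, fun ξ ↦ inferInstance, fun {ξ ξ'} f ↦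
    .of_leftInverse (fun n ↦ ?_) ⟨0, fun s m ↦ ?_⟩⟩
  · rw [Subsingleton.elim n 0]
    exact zero_mem _
  · rw [Subsingleton.elim m 0, TensorProduct.tmul_zero]
    rfl

open scoped ZeroObject

instance : ObjectProperty.IsClosedUnderExtensions (IsLocFree (O := O)) where
  prop_X₂_of_shortExact h h₁ h₃ := X₂ h h₁ h₃

instance : ObjectProperty.ContainsZero (IsLocFree (O := O)) where
  exists_zero := ⟨0, isZero_zero _, of_isZero (isZero_zero _)⟩

instance : ObjectProperty.IsClosedUnderIsomorphisms (IsLocFree (O := O)) where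
  of_iso {M N} e h := by
    let S : ShortComplex (OMod O) := ShortComplex.mk e.hom (0 : N ⟶ 0) comp_zero
    have hS : S.ShortExact :=
      { exact := (S.exact_iff_epi rfl).2 (inferInstanceAs (Epi e.hom))
        mono_f := inferInstanceAs (Mono e.hom)
        epi_g := ⟨fun _ _ _ ↦ (isZero_zero (OMod O)).eq_of_src _ _⟩ }
    exact X₂ hS h (of_isZero (isZero_zero _))

end IsLocFree

end Stk

/-! ### Dual bases and their base change. -/

/-- A finite projective module has a finite dual basis. -/
lemma Module.exists_dualBasis (R M : Type*) [CommRing R] [AddCommGroup M] [Module R M]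
    [Module.Finite R M] [Module.Projective R M] :
    ∃ (k : ℕ) (φ : Fin k → M →ₗ[R] R) (e : Fin k → M), ∀ m, ∑ i, φ i m • e i = m := by
  obtain ⟨k, f, g, -, -, hfg⟩ := Module.Finite.exists_comp_eq_id_of_projective R M
  refine ⟨k, fun i ↦ LinearMap.proj i ∘ₗ g, fun i ↦ f (Pi.single i 1), fun m ↦ ?_⟩
  have h : f (g m) = m := congr($hfg m)
  conv_rhs => rw [← h, pi_eq_sum_univ' (g m), map_sum]
  simp

/-- The base change of a dual basis. -/
lemma Stk.IsBaseChangeAlong.exists_dualBasis {R S M N : Type u} [CommRing R] [CommRing S]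
    [AddCommGroup M] [AddCommGroup N] [Module R M] [Module S N] {φ : R →+* S} {f : M →ₛₗ[φ] N}
    (h : IsBaseChangeAlong φ f) {k : ℕ} (ψ : Fin k → M →ₗ[R] R) (e : Fin k → M)
    (he : ∀ m, ∑ i, ψ i m • e i = m) :
    ∃ ψ' : Fin k → N →ₗ[S] S, (∀ i m, ψ' i (f m) = φ (ψ i m)) ∧
      ∀ n, ∑ i, ψ' i n • f (e i) = n := by
  have (i : Fin k) : ∃ ψ' : N →ₗ[S] S, ∀ m, ψ' (f m) = φ (ψ i m) := by
    let g : M →ₛₗ[φ] S :=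
      { toFun := fun m ↦ φ (ψ i m), map_add' := by simp, map_smul' := by simp }
    exact h.exists_lift_linear g
  choose ψ' hψ' using this
  refine ⟨ψ', hψ', fun n ↦ ?_⟩
  induction n using h.induction with
  | zero => simp
  | add a b ha hb => simp only [map_add, add_smul, Finset.sum_add_distrib, ha, hb]
  | smul s m =>
    conv_rhs => rw [← he m, map_sum, Finset.smul_sum]
    exact Finset.sum_congr rfl fun i _ ↦ by
      rw [map_smul, hψ', f.map_smulₛₗ, smul_eq_mul, mul_smul]

/-! ### Modules with an action of the algebra of the cover are injective and projective. -/

namespace Stk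

open OMod

variable {C : Type*} [Category* C] {O : Cᵒᵖ ⥤ CommRingCat.{u}}

section Extend

variable {X Y : OMod O} (hX : IsLocFree X) {a : Cᵒᵖ} (k : X.obj a →ₗ[O.obj a] Y.obj a)

include hX in
lemma IsLocFree.exists_extend {η : Cᵒᵖ} (p : a ⟶ η) :
    ∃ k' : X.obj η →ₗ[O.obj η] Y.obj η, ∀ x, k' (X.res p x) = Y.res p (k x) :=
  (hX.baseChange p).exists_lift_linear ((Y.res p).comp k)

/-- The base change along `p : a ⟶ η` of a linear map between the values at `a`. -/
def IsLocFree.extend {η : Cᵒᵖ} (p : a ⟶ η) : X.obj η →ₗ[O.obj η] Y.obj η :=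
  (hX.exists_extend k p).choose

lemma IsLocFree.extend_res {η : Cᵒᵖ} (p : a ⟶ η) (x : X.obj a) :
    hX.extend k p (X.res p x) = Y.res p (k x) :=
  (hX.exists_extend k p).choose_spec x

/-- A splitting chosen once at the covering object becomes natural after pullback to the objects `T
ξ`: with `p = inl ξ` and `q = T.map f`, the hypothesis `w` is `inl_map`. -/
lemma IsLocFree.res_extend {η η' : Cᵒᵖ} (p : a ⟶ η) (q : η ⟶ η') (p' : a ⟶ η') (w : p ≫ q = p')
    (x : X.obj η) : Y.res q (hX.extend k p x) = hX.extend k p' (X.res q x) := by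
  subst w
  induction x using (hX.baseChange p).induction with
  | zero => simp
  | add a b ha hb => simp only [map_add, ha, hb]
  | smul s m => rw [map_smul, res_smul, res_smul, map_smul, ← res_comp, extend_res, extend_res,
      ← res_comp]

end Extend

variable (C) in
/-- A functor `T` on the opposite of `C`, to be thought of as the coproduct with the object `pt`. -/
structure CoverData where
  /-- the covering object -/
  pt : Cᵒᵖ
  /-- the coproduct with the covering object -/
  T : Cᵒᵖ ⥤ Cᵒᵖ
  /-- the first coprojection -/
  inl (ξ : Cᵒᵖ) : pt ⟶ T.obj ξ
  /-- the second coprojection -/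
  inr (ξ : Cᵒᵖ) : ξ ⟶ T.obj ξ
  inl_map {ξ ξ' : Cᵒᵖ} (f : ξ ⟶ ξ') : inl ξ ≫ T.map f = inl ξ'
  inr_map {ξ ξ' : Cᵒᵖ} (f : ξ ⟶ ξ') : inr ξ ≫ T.map f = f ≫ inr ξ'

namespace CoverData

variable (d : CoverData C)

instance algebra (ξ : Cᵒᵖ) : Algebra (O.obj ξ) (O.obj (d.T.obj ξ)) :=
  (O.map (d.inr ξ)).hom.toAlgebra

lemma map_algebraMap {ξ ξ' : Cᵒᵖ} (f : ξ ⟶ ξ') (r : O.obj ξ) :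
    (O.map (d.T.map f)).hom (algebraMap (O.obj ξ) (O.obj (d.T.obj ξ)) r) =
      algebraMap (O.obj ξ') (O.obj (d.T.obj ξ')) ((O.map f).hom r) := by
  change (O.map (d.inr ξ) ≫ O.map (d.T.map f)).hom r = (O.map f ≫ O.map (d.inr ξ')).hom r
  rw [← O.map_comp, ← O.map_comp, inr_map]

/-- The restriction maps of the sheaf of algebras given by the values of `O` at `T ξ`. -/
def resT {ξ ξ' : Cᵒᵖ} (f : ξ ⟶ ξ') :
    O.obj (d.T.obj ξ) →ₛₗ[(O.map f).hom] O.obj (d.T.obj ξ') where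
  toFun := (O.map (d.T.map f)).hom
  map_add' := map_add _
  map_smul' r b := by
    rw [Algebra.smul_def, Algebra.smul_def, map_mul, map_algebraMap]

/-- An action of the sheaf of algebras given by the values of `O` at `T ξ`. -/
structure Action (N : OMod O) where
  /-- the action -/
  act (ξ : Cᵒᵖ) : O.obj (d.T.obj ξ) →+* AddMonoid.End (N.obj ξ)
  act_algebraMap {ξ : Cᵒᵖ} (r : O.obj ξ) (n : N.obj ξ) :
    act ξ (algebraMap (O.obj ξ) (O.obj (d.T.obj ξ)) r) n = r • n
  res_act {ξ ξ' : Cᵒᵖ} (f : ξ ⟶ ξ') (b : O.obj (d.T.obj ξ)) (n : N.obj ξ) :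
    N.res f (act ξ b n) = act ξ' (d.resT f b) (N.res f n)

namespace Action

variable {d} {N : OMod O} (A : d.Action N)

lemma act_mul {ξ : Cᵒᵖ} (b c : O.obj (d.T.obj ξ)) (n : N.obj ξ) :
    A.act ξ (b * c) n = A.act ξ b (A.act ξ c n) := by
  rw [map_mul]; rfl

lemma act_add {ξ : Cᵒᵖ} (b c : O.obj (d.T.obj ξ)) (n : N.obj ξ) :
    A.act ξ (b + c) n = A.act ξ b n + A.act ξ c n := by
  rw [map_add]; rfl

lemma act_smul {ξ : Cᵒᵖ} (b : O.obj (d.T.obj ξ)) (r : O.obj ξ) (n : N.obj ξ) :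
    A.act ξ b (r • n) = r • A.act ξ b n := by
  rw [← A.act_algebraMap, ← A.act_algebraMap, ← act_mul, ← act_mul, mul_comm]

lemma act_mul_algebraMap {ξ : Cᵒᵖ} (b : O.obj (d.T.obj ξ)) (r : O.obj ξ) (n : N.obj ξ) :
    A.act ξ (b * algebraMap (O.obj ξ) (O.obj (d.T.obj ξ)) r) n = A.act ξ b (r • n) := by
  rw [act_mul, act_algebraMap]

section Injective

variable {X : OMod O} (hX : IsLocFree X) (h : X ⟶ N)

-- The formula `b ⊗ x ↦ b · h x` is balanced because the action restricts to the given module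
-- structure along `O(ξ) → O(T ξ)`.
include hX in
lemma exists_adjoint (ξ : Cᵒᵖ) : ∃ k : X.obj (d.T.obj ξ) →+ N.obj ξ,
    ∀ b x, k (b • X.res (d.inr ξ) x) = A.act ξ b (appₗ h ξ x) :=
  (hX.baseChange (d.inr ξ)).exists_lift
    (AddMonoidHom.mk' (fun b ↦ (A.act ξ b).comp (appₗ h ξ).toAddMonoidHom)
      fun a b ↦ AddMonoidHom.ext fun x ↦ A.act_add a b _)
    fun b r x ↦ by
      change A.act ξ (b * algebraMap (O.obj ξ) (O.obj (d.T.obj ξ)) r) _ = A.act ξ b _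
      rw [act_mul_algebraMap]
      exact congrArg _ (map_smul (appₗ h ξ) r x).symm

/-- The linear extension `X(T ξ) → N(ξ)` of a morphism `X ⟶ N`. -/
def adjoint (ξ : Cᵒᵖ) : X.obj (d.T.obj ξ) →+ N.obj ξ := (A.exists_adjoint hX h ξ).choose

lemma adjoint_smul_res {ξ : Cᵒᵖ} (b : O.obj (d.T.obj ξ)) (x : X.obj ξ) :
    A.adjoint hX h ξ (b • X.res (d.inr ξ) x) = A.act ξ b (appₗ h ξ x) :=
  (A.exists_adjoint hX h ξ).choose_spec b x

lemma adjoint_res {ξ : Cᵒᵖ} (x : X.obj ξ) :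
    A.adjoint hX h ξ (X.res (d.inr ξ) x) = appₗ h ξ x := by
  simpa using A.adjoint_smul_res hX h 1 x

lemma adjoint_smul {ξ : Cᵒᵖ} (b : O.obj (d.T.obj ξ)) (x : X.obj (d.T.obj ξ)) :
    A.adjoint hX h ξ (b • x) = A.act ξ b (A.adjoint hX h ξ x) := by
  induction x using (hX.baseChange (d.inr ξ)).induction with
  | zero => simp
  | add a b ha hb => simp only [smul_add, map_add, ha, hb]
  | smul s m => rw [smul_smul, adjoint_smul_res, adjoint_smul_res, act_mul]

lemma res_adjoint {ξ ξ' : Cᵒᵖ} (f : ξ ⟶ ξ') (x : X.obj (d.T.obj ξ)) :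
    N.res f (A.adjoint hX h ξ x) = A.adjoint hX h ξ' (X.res (d.T.map f) x) := by
  induction x using (hX.baseChange (d.inr ξ)).induction with
  | zero => simp
  | add a b ha hb => simp only [map_add, ha, hb]
  | smul s m =>
    rw [adjoint_smul_res, res_act, res_smul, ← res_comp, X.res_congr (d.inr_map f), res_comp]
    exact (by rw [adjoint_smul_res, appₗ_res]; rfl)

end Injective

include A in
/-- Modules with an action are injective with respect to short exact sequences of locally free
modules. -/
theorem exists_extension {S : ShortComplex (OMod O)} (hS : S.ShortExact)
    (h₁ : IsLocFree S.X₁) (h₂ : IsLocFree S.X₂) (h₃ : IsLocFree S.X₃) (h : S.X₁ ⟶ N) :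
    ∃ l : S.X₂ ⟶ N, S.f ≫ l = h := by
  obtain ⟨r, hr⟩ : ∃ r, r ∘ₗ appₗ S.f d.pt = LinearMap.id := IsLocFree.exists_retraction hS h₃ d.pt
  have key (ξ : Cᵒᵖ) (x : S.X₁.obj (d.T.obj ξ)) :
      h₂.extend r (d.inl ξ) (appₗ S.f _ x) = x := by
    induction x using (h₁.baseChange (d.inl ξ)).induction with
    | zero => simp
    | add a b ha hb => simp only [map_add, ha, hb]
    | smul s m =>
      rw [map_smul, map_smul, appₗ_res, h₂.extend_res]
      exact congr(_ • S.X₁.res (d.inl ξ) ($hr m))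
  -- Restrict to `T ξ`, apply the pulled-back retraction there, and return to `N(ξ)` through the
  -- action.
  refine ⟨homOfNatural (fun ξ ↦
    { toFun := fun y ↦ A.adjoint h₁ h ξ (h₂.extend r (d.inl ξ) (S.X₂.res (d.inr ξ) y))
      map_add' := by simp
      map_smul' := fun a y ↦ by
        rw [res_smul, map_smul, adjoint_smul]
        exact A.act_algebraMap _ _ }) fun {ξ ξ'} f y ↦ ?_, hom_ext fun ξ x ↦ ?_⟩
  · change A.adjoint h₁ h ξ' _ = N.res f (A.adjoint h₁ h ξ _)
    rw [res_adjoint, h₂.res_extend r _ _ _ (d.inl_map f), ← res_comp, ← res_comp,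
      S.X₂.res_congr (d.inr_map f)]
  · change A.adjoint h₁ h ξ (h₂.extend r (d.inl ξ) (S.X₂.res (d.inr ξ) (appₗ S.f ξ x))) = _
    rw [← appₗ_res, key, adjoint_res]

section Projective

variable (A : d.Action N)

lemma exists_contr {Y : OMod O} (hY : IsLocFree Y) {ξ : Cᵒᵖ} (φ : N.obj ξ →ₗ[O.obj ξ] O.obj ξ)
    (n : N.obj ξ) : ∃ k : Y.obj (d.T.obj ξ) →+ Y.obj ξ,
      ∀ b y, k (b • Y.res (d.inr ξ) y) = φ (A.act ξ b n) • y :=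
  (hY.baseChange (d.inr ξ)).exists_lift
    (AddMonoidHom.mk' (fun b ↦ AddMonoidHom.mk' (fun y : Y.obj ξ ↦ φ (A.act ξ b n) • y)
      fun a b ↦ smul_add _ _ _) fun a b ↦ AddMonoidHom.ext fun y ↦ by
        change φ (A.act ξ (a + b) n) • y = φ (A.act ξ a n) • y + φ (A.act ξ b n) • y
        rw [act_add, map_add, add_smul])
    fun b r y ↦ by
      change φ (A.act ξ (b * algebraMap (O.obj ξ) (O.obj (d.T.obj ξ)) r) n) • y =
        φ (A.act ξ b n) • r • y
      rw [act_mul_algebraMap, act_smul, map_smul, smul_smul, smul_eq_mul, mul_comm]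

/-- The contraction `b ⊗ y ↦ φ (b n) y` from `Y(T ξ)` to `Y(ξ)` for a linear form `φ` on `N(ξ)`
and `n ∈ N(ξ)`. -/
def contr {Y : OMod O} (hY : IsLocFree Y) {ξ : Cᵒᵖ} (φ : N.obj ξ →ₗ[O.obj ξ] O.obj ξ)
    (n : N.obj ξ) : Y.obj (d.T.obj ξ) →+ Y.obj ξ :=
  (A.exists_contr hY φ n).choose

section

variable {Y : OMod O} (hY : IsLocFree Y) {ξ : Cᵒᵖ} (φ : N.obj ξ →ₗ[O.obj ξ] O.obj ξ)

lemma contr_smul_res (n : N.obj ξ) (b : O.obj (d.T.obj ξ)) (y : Y.obj ξ) :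
    A.contr hY φ n (b • Y.res (d.inr ξ) y) = φ (A.act ξ b n) • y :=
  (A.exists_contr hY φ n).choose_spec b y

lemma contr_res (n : N.obj ξ) (y : Y.obj ξ) :
    A.contr hY φ n (Y.res (d.inr ξ) y) = φ n • y := by
  simpa using A.contr_smul_res hY φ n 1 y

lemma contr_add (n n' : N.obj ξ) (u : Y.obj (d.T.obj ξ)) :
    A.contr hY φ (n + n') u = A.contr hY φ n u + A.contr hY φ n' u := by
  induction u using (hY.baseChange (d.inr ξ)).induction with
  | zero => simp
  | add a b ha hb => simp only [map_add, ha, hb]; abel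
  | smul s m => simp only [contr_smul_res, map_add, add_smul]

lemma contr_smul (r : O.obj ξ) (n : N.obj ξ) (u : Y.obj (d.T.obj ξ)) :
    A.contr hY φ (r • n) u = r • A.contr hY φ n u := by
  induction u using (hY.baseChange (d.inr ξ)).induction with
  | zero => simp
  | add a b ha hb => simp only [map_add, ha, hb, smul_add]
  | smul s m => simp only [contr_smul_res, act_smul, map_smul, smul_eq_mul, mul_smul]

lemma contr_algebraMap_smul (r : O.obj ξ) (n : N.obj ξ) (u : Y.obj (d.T.obj ξ)) :
    A.contr hY φ n ((O.map (d.inr ξ)).hom r • u) = r • A.contr hY φ n u := by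
  induction u using (hY.baseChange (d.inr ξ)).induction with
  | zero => simp
  | add a b ha hb => simp only [map_add, ha, hb, smul_add]
  | smul s m =>
    rw [smul_smul, mul_comm, contr_smul_res, contr_smul_res]
    change φ (A.act ξ (s * algebraMap (O.obj ξ) (O.obj (d.T.obj ξ)) r) n) • m = _
    rw [act_mul_algebraMap, act_smul, map_smul, smul_eq_mul, mul_smul]

/-- Linearity of the contraction in the linear form, stated for the expansion of a form in a dual
basis. -/
lemma contr_sum {k : ℕ} (r : Fin k → O.obj ξ) (ψ : Fin k → N.obj ξ →ₗ[O.obj ξ] O.obj ξ)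
    (hφ : ∀ n, φ n = ∑ i, r i * ψ i n) (n : N.obj ξ) (u : Y.obj (d.T.obj ξ)) :
    A.contr hY φ n u = ∑ i, r i • A.contr hY (ψ i) n u := by
  induction u using (hY.baseChange (d.inr ξ)).induction with
  | zero => simp
  | add a b ha hb => simp only [map_add, ha, hb, smul_add, Finset.sum_add_distrib]
  | smul s m => simp only [contr_smul_res, hφ, Finset.sum_smul, mul_smul]

lemma appₗ_contr {Z : OMod O} (hZ : IsLocFree Z) (g : Y ⟶ Z) (n : N.obj ξ)
    (u : Y.obj (d.T.obj ξ)) :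
    appₗ g ξ (A.contr hY φ n u) = A.contr hZ φ n (appₗ g _ u) := by
  induction u using (hY.baseChange (d.inr ξ)).induction with
  | zero => simp
  | add a b ha hb => simp only [map_add, ha, hb]
  | smul s m => rw [contr_smul_res, map_smul, map_smul, appₗ_res, contr_smul_res]

lemma res_contr {ξ' : Cᵒᵖ} (f : ξ ⟶ ξ') (φ' : N.obj ξ' →ₗ[O.obj ξ'] O.obj ξ')
    (hφ : ∀ n, φ' (N.res f n) = (O.map f).hom (φ n)) (n : N.obj ξ) (u : Y.obj (d.T.obj ξ)) :
    Y.res f (A.contr hY φ n u) = A.contr hY φ' (N.res f n) (Y.res (d.T.map f) u) := by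
  induction u using (hY.baseChange (d.inr ξ)).induction with
  | zero => simp
  | add a b ha hb => simp only [map_add, ha, hb]
  | smul s m =>
    rw [contr_smul_res, res_smul, res_smul, ← res_comp, Y.res_congr (d.inr_map f), res_comp,
      contr_smul_res, ← hφ, res_act]
    rfl

/-- The element `∑ i, contr (ψ i) n (t (e i))` does not depend on the choice of the dual basis
`(ψ, e)` of `N(ξ)`. -/
lemma sum_contr_eq {k k' : ℕ} {ψ : Fin k → N.obj ξ →ₗ[O.obj ξ] O.obj ξ} {e : Fin k → N.obj ξ}
    (he : ∀ n, ∑ i, ψ i n • e i = n)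
    {ψ' : Fin k' → N.obj ξ →ₗ[O.obj ξ] O.obj ξ} {e' : Fin k' → N.obj ξ}
    (he' : ∀ n, ∑ i, ψ' i n • e' i = n) (t : N.obj ξ →+ Y.obj (d.T.obj ξ))
    (ht : ∀ (r : O.obj ξ) n, t (r • n) = (O.map (d.inr ξ)).hom r • t n) (n : N.obj ξ) :
    ∑ i, A.contr hY (ψ i) n (t (e i)) = ∑ j, A.contr hY (ψ' j) n (t (e' j)) := by
  have h₁ (j : Fin k') : A.contr hY (ψ' j) n (t (e' j)) =
      ∑ i, A.contr hY (ψ i) n (t (ψ' j (e i) • e' j)) := by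
    -- Expand `ψ' j = ∑ i, ψ' j (e i) ψ i`. After exchanging the sums, `∑ j, ψ' j (e i) e' j`
    -- recombines to `e i`.
    rw [A.contr_sum hY (ψ' j) (fun i ↦ ψ' j (e i)) ψ fun m ↦ ?_]
    · simp only [ht, contr_algebraMap_smul]
    · conv_lhs => rw [← he m, map_sum]
      exact Finset.sum_congr rfl fun i _ ↦ by rw [map_smul, smul_eq_mul, mul_comm]
  simp only [h₁]
  rw [Finset.sum_comm]
  exact Finset.sum_congr rfl fun i _ ↦ by
    conv_lhs => rw [← he' (e i), map_sum, map_sum]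

end

include A in
/-- Locally free modules with an action are projective with respect to short exact sequences of
locally free modules. -/
theorem exists_lift (hN : IsLocFree N) {S : ShortComplex (OMod O)} (hS : S.ShortExact)
    (h₂ : IsLocFree S.X₂) (h₃ : IsLocFree S.X₃) (h : N ⟶ S.X₃) :
    ∃ l : N ⟶ S.X₂, l ≫ S.g = h := by
  obtain ⟨s, hs⟩ : ∃ s, appₗ S.g d.pt ∘ₗ s = LinearMap.id :=
    IsLocFree.exists_section hS h₃ d.pt
  have key (ξ : Cᵒᵖ) (x : S.X₃.obj (d.T.obj ξ)) :
      appₗ S.g _ (h₃.extend s (d.inl ξ) x) = x := by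
    induction x using (h₃.baseChange (d.inl ξ)).induction with
    | zero => simp
    | add a b ha hb => simp only [map_add, ha, hb]
    | smul s m =>
      rw [map_smul, map_smul, h₃.extend_res, appₗ_res]
      exact congr(_ • S.X₃.res (d.inl ξ) ($hs m))
  have dual (ξ : Cᵒᵖ) : ∃ (k : ℕ) (φ : Fin k → N.obj ξ →ₗ[O.obj ξ] O.obj ξ)
      (e : Fin k → N.obj ξ), ∀ m, ∑ i, φ i m • e i = m :=
    have := hN.finite ξ
    have := hN.projective ξ
    Module.exists_dualBasis _ _
  choose k φ e he using dual
  let t (ξ : Cᵒᵖ) : N.obj ξ →+ S.X₂.obj (d.T.obj ξ) :=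
    (h₃.extend s (d.inl ξ)).toAddMonoidHom.comp
      ((S.X₃.res (d.inr ξ)).toAddMonoidHom.comp (appₗ h ξ).toAddMonoidHom)
  have t_apply (ξ : Cᵒᵖ) (n) :
      t ξ n = h₃.extend s (d.inl ξ) (S.X₃.res (d.inr ξ) (appₗ h ξ n)) := rfl
  have t_smul (ξ : Cᵒᵖ) (r : O.obj ξ) (n) : t ξ (r • n) = (O.map (d.inr ξ)).hom r • t ξ n := by
    rw [t_apply, t_apply, map_smul, res_smul, map_smul]
  refine ⟨homOfNatural (fun ξ ↦
    { toFun := fun n ↦ ∑ i, A.contr h₂ (φ ξ i) n (t ξ (e ξ i))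
      map_add' := fun n n' ↦ by simp only [contr_add, Finset.sum_add_distrib]
      map_smul' := fun r n ↦ by
        simp only [contr_smul, Finset.smul_sum, RingHom.id_apply] }) fun {ξ ξ'} f n ↦ ?_,
    hom_ext fun ξ n ↦ ?_⟩
  · change ∑ i, A.contr h₂ (φ ξ' i) (N.res f n) (t ξ' (e ξ' i)) =
      S.X₂.res f (∑ i, A.contr h₂ (φ ξ i) n (t ξ (e ξ i)))
    -- The dual bases at `ξ` and `ξ'` were chosen independently. Independence of the basis allows
    -- the one at `ξ'` to be replaced by the base change of the one at `ξ`, after which the sums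
    -- agree term by term.
    obtain ⟨φ', hφ', he'⟩ := (hN.baseChange f).exists_dualBasis (φ ξ) (e ξ) (he ξ)
    rw [A.sum_contr_eq h₂ (he ξ') he' (t ξ') (t_smul ξ'), map_sum]
    refine Finset.sum_congr rfl fun i _ ↦ ?_
    rw [A.res_contr h₂ (φ ξ i) f (φ' i) (hφ' i), t_apply, t_apply,
      h₃.res_extend s _ _ _ (d.inl_map f), appₗ_res, ← res_comp, ← res_comp,
      S.X₃.res_congr (d.inr_map f)]
  · change appₗ S.g ξ (∑ i, A.contr h₂ (φ ξ i) n (t ξ (e ξ i))) = _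
    conv_rhs => rw [← he ξ n]
    rw [map_sum, map_sum]
    refine Finset.sum_congr rfl fun i _ ↦ ?_
    -- The image of `t (e i)` in `X₃(T ξ)` is the restriction `1 ⊗ h (e i)`, and contracting it
    -- gives `φ i n • h (e i)`.
    rw [A.appₗ_contr h₂ _ h₃, t_apply, key, contr_res, map_smul]

end Projective

end Action

end CoverData

end Stk

/-! ### Coinduced modules. -/

section

variable {R B M : Type*} [CommRing R] [AddCommGroup B] [AddCommGroup M] [Module R B]
  [Module R M] [Module.Finite R B] [Module.Projective R B]

lemma Module.Finite.linearMap_of_projective [Module.Finite R M] :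
    Module.Finite R (B →ₗ[R] M) := by
  obtain ⟨k, φ, e, he⟩ := Module.exists_dualBasis R B
  let p : (Fin k → M) →ₗ[R] (B →ₗ[R] M) := ∑ i, (LinearMap.smulRightₗ (φ i)) ∘ₗ LinearMap.proj i
  refine Module.Finite.of_surjective p fun u ↦ ⟨fun i ↦ u (e i), LinearMap.ext fun b ↦ ?_⟩
  conv_rhs => rw [← he b, map_sum]
  simp [p]

lemma Module.Projective.linearMap_of_projective [Module.Projective R M] :
    Module.Projective R (B →ₗ[R] M) :=
  Module.Projective.of_equiv (dualTensorHomEquiv R B M)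

end

/-- A dual basis `(ψ, e)` of `B` writes every `u` as `∑ i, ψ i ⊗ u (e i)`, and its base change does
the same over `S`. This reduces the claim to the base change property of `M`, applied to each
coefficient. -/
lemma Stk.IsBaseChangeAlong.linearMap {R S B B' M M' : Type u} [CommRing R] [CommRing S]
    [AddCommGroup M] [AddCommGroup M'] [Module R M] [Module S M'] [AddCommGroup B]
    [AddCommGroup B'] [Module R B] [Module S B'] {φ : R →+* S} {f : M →ₛₗ[φ] M'}
    {b : B →ₛₗ[φ] B'} (hf : IsBaseChangeAlong φ f) (hb : IsBaseChangeAlong φ b)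
    [Module.Finite R B] [Module.Projective R B] {r : (B →ₗ[R] M) →ₛₗ[φ] (B' →ₗ[S] M')}
    (hr : ∀ u x, r u (b x) = f (u x)) : IsBaseChangeAlong φ r := by
  obtain ⟨k, ψ, e, he⟩ := Module.exists_dualBasis R B
  obtain ⟨ψ', hψ', he'⟩ := hb.exists_dualBasis ψ e he
  have hu (u : B →ₗ[R] M) : ∑ i, (ψ i).smulRight (u (e i)) = u := LinearMap.ext fun x ↦ by
    conv_rhs => rw [← he x, map_sum]
    simp
  have hu' (u : B' →ₗ[S] M') : ∑ i, (ψ' i).smulRight (u (b (e i))) = u :=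
    LinearMap.ext fun x ↦ by
      conv_rhs => rw [← he' x, map_sum]
      simp
  have hrψ (i m) : r ((ψ i).smulRight m) = (ψ' i).smulRight (f m) := hb.linear_ext fun x ↦ by
    rw [hr]
    simp [hψ']
  refine .of_leftInverse (fun u ↦ ?_) ?_
  · rw [← hu' u]
    refine Submodule.sum_mem _ fun i _ ↦ ?_
    induction u (b (e i)) using hf.induction with
    | zero =>
      convert Submodule.zero_mem _
      exact LinearMap.ext fun x ↦ by simp
    | add m m' hm hm' =>
      convert Submodule.add_mem _ hm hm'
      exact LinearMap.ext fun x ↦ by simp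
    | smul s m =>
      have : (ψ' i).smulRight (s • f m) = s • r ((ψ i).smulRight m) := by
        rw [hrψ]
        exact LinearMap.ext fun x ↦ smul_comm _ _ _
      rw [this]
      exact Submodule.smul_mem _ _ (Submodule.subset_span ⟨_, rfl⟩)
  · let := φ.toAlgebra
    have (i : Fin k) : ∃ τ : M' →+ S ⊗[R] (B →ₗ[R] M),
        ∀ s m, τ (s • f m) = s ⊗ₜ (ψ i).smulRight m :=
      hf.exists_lift (AddMonoidHom.mk' (fun s ↦ AddMonoidHom.mk'
        (fun m ↦ s ⊗ₜ[R] (ψ i).smulRight m) fun m m' ↦ by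
          rw [← TensorProduct.tmul_add]
          congr 1
          exact LinearMap.ext fun x ↦ by simp)
        fun s s' ↦ AddMonoidHom.ext fun m ↦ TensorProduct.add_tmul _ _ _) fun s r m ↦ by
          change (s * φ r) ⊗ₜ[R] (ψ i).smulRight m = s ⊗ₜ[R] (ψ i).smulRight (r • m)
          have : (ψ i).smulRight (r • m) = r • (ψ i).smulRight m :=
            LinearMap.ext fun x ↦ smul_comm _ _ _
          rw [this, ← TensorProduct.smul_tmul, Algebra.smul_def, mul_comm]
          rfl
    choose τ hτ using this
    -- The inverse sends `u` to the sum over `i` of its coefficients `u (b (e i))`, each carried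
    -- into `S ⊗ Hom(B, M)` through `ψ i`.
    refine ⟨AddMonoidHom.mk' (fun u ↦ ∑ i, τ i (u (b (e i)))) fun u v ↦ by
      simp [Finset.sum_add_distrib], fun s u ↦ ?_⟩
    change ∑ i, τ i ((s • r u) (b (e i))) = _
    simp only [LinearMap.smul_apply, hr, hτ]
    rw [← TensorProduct.tmul_sum, hu]

namespace Stk

open OMod

variable {C : Type*} [Category* C] {O : Cᵒᵖ ⥤ CommRingCat.{u}}

namespace CoverData

variable (O) (d : CoverData C)

/-- The values of `O` at `T ξ` form a locally free sheaf of algebras that admits, for all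
`ξ`, a linear retraction onto the value of `O` at `ξ`. -/
structure IsFiniteLocallyFree : Prop where
  finite (ξ : Cᵒᵖ) : Module.Finite (O.obj ξ) (O.obj (d.T.obj ξ))
  projective (ξ : Cᵒᵖ) : Module.Projective (O.obj ξ) (O.obj (d.T.obj ξ))
  baseChange {ξ ξ' : Cᵒᵖ} (f : ξ ⟶ ξ') :
    IsBaseChangeAlong (O.map f).hom (d.resT (O := O) f)
  exists_retraction (ξ : Cᵒᵖ) : ∃ ρ : O.obj (d.T.obj ξ) →ₗ[O.obj ξ] O.obj ξ, ρ 1 = 1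

variable {O d}

lemma resT_id (ξ : Cᵒᵖ) (b : O.obj (d.T.obj ξ)) : d.resT (𝟙 ξ) b = b := by
  change (O.map (d.T.map (𝟙 ξ))).hom b = b
  simp

lemma resT_comp {ξ ξ' ξ'' : Cᵒᵖ} (f : ξ ⟶ ξ') (g : ξ' ⟶ ξ'') (b : O.obj (d.T.obj ξ)) :
    d.resT (f ≫ g) b = d.resT g (d.resT f b) := by
  change (O.map (d.T.map (f ≫ g))).hom b = _
  simp
  rfl

lemma resT_one {ξ ξ' : Cᵒᵖ} (f : ξ ⟶ ξ') : d.resT (O := O) f 1 = 1 := map_one (O.map _).hom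

lemma resT_mul {ξ ξ' : Cᵒᵖ} (f : ξ ⟶ ξ') (b c : O.obj (d.T.obj ξ)) :
    d.resT f (b * c) = d.resT f b * d.resT f c := map_mul (O.map _).hom b c

namespace IsFiniteLocallyFree

variable (hd : d.IsFiniteLocallyFree O) (M : OMod O)

include hd in
lemma exists_homRes {ξ ξ' : Cᵒᵖ} (f : ξ ⟶ ξ') (u : O.obj (d.T.obj ξ) →ₗ[O.obj ξ] M.obj ξ) :
    ∃ u' : O.obj (d.T.obj ξ') →ₗ[O.obj ξ'] M.obj ξ', ∀ b, u' (d.resT f b) = M.res f (u b) :=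
  (hd.baseChange f).exists_lift_linear ((M.res f).comp u)

variable {M} in
include hd in
lemma hom_ext {ξ ξ' : Cᵒᵖ} (f : ξ ⟶ ξ') {u u' : O.obj (d.T.obj ξ') →ₗ[O.obj ξ'] M.obj ξ'}
    (h : ∀ b, u (d.resT f b) = u' (d.resT f b)) : u = u' :=
  (hd.baseChange f).linear_ext h

/-- The restriction maps of the coinduced module. -/
def homRes {ξ ξ' : Cᵒᵖ} (f : ξ ⟶ ξ') : (O.obj (d.T.obj ξ) →ₗ[O.obj ξ] M.obj ξ) →ₛₗ[(O.map f).hom]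
    (O.obj (d.T.obj ξ') →ₗ[O.obj ξ'] M.obj ξ') where
  toFun u := (hd.exists_homRes M f u).choose
  map_add' u v := hd.hom_ext f fun b ↦ by
    rw [LinearMap.add_apply, (hd.exists_homRes M f u).choose_spec,
      (hd.exists_homRes M f v).choose_spec, (hd.exists_homRes M f (u + v)).choose_spec,
      LinearMap.add_apply, map_add]
  map_smul' r u := hd.hom_ext f fun b ↦ by
    rw [LinearMap.smul_apply, (hd.exists_homRes M f u).choose_spec,
      (hd.exists_homRes M f (r • u)).choose_spec, LinearMap.smul_apply, res_smul]

lemma homRes_resT {ξ ξ' : Cᵒᵖ} (f : ξ ⟶ ξ') (u : O.obj (d.T.obj ξ) →ₗ[O.obj ξ] M.obj ξ)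
    (b : O.obj (d.T.obj ξ)) : hd.homRes M f u (d.resT f b) = M.res f (u b) :=
  (hd.exists_homRes M f u).choose_spec b

/-- The coinduced module, whose value at `ξ` is the module of `O(ξ)`-linear maps from `O(T ξ)` to
`M(ξ)`. -/
def coind : OMod O :=
  ofFamily (fun ξ ↦ O.obj (d.T.obj ξ) →ₗ[O.obj ξ] M.obj ξ) (fun f ↦ hd.homRes M f)
    (fun ξ u ↦ hd.hom_ext (𝟙 ξ) fun b ↦ by rw [homRes_resT, resT_id, res_id])
    (fun f g u ↦ hd.hom_ext (f ≫ g) fun b ↦ by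
      rw [homRes_resT, resT_comp, homRes_resT, homRes_resT, res_comp])

/-- The action on the coinduced module. -/
def coindAction : d.Action (hd.coind M) where
  act ξ :=
    { toFun := fun b ↦ AddMonoidHom.mk'
        (fun u : O.obj (d.T.obj ξ) →ₗ[O.obj ξ] M.obj ξ ↦ u ∘ₗ LinearMap.mulLeft _ b)
        fun u v ↦ rfl
      map_one' := AddMonoidHom.ext fun u ↦ LinearMap.ext fun b ↦ congrArg _ (one_mul b)
      map_zero' := AddMonoidHom.ext
        fun u : O.obj (d.T.obj ξ) →ₗ[O.obj ξ] M.obj ξ ↦ LinearMap.ext fun b ↦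
          (congrArg u (zero_mul b)).trans u.map_zero
      map_mul' := fun a c ↦ AddMonoidHom.ext
        fun u : O.obj (d.T.obj ξ) →ₗ[O.obj ξ] M.obj ξ ↦ LinearMap.ext fun b ↦
          congrArg u (show a * c * b = c * (a * b) by rw [mul_comm a c, mul_assoc])
      map_add' := fun a c ↦ AddMonoidHom.ext
        fun u : O.obj (d.T.obj ξ) →ₗ[O.obj ξ] M.obj ξ ↦ LinearMap.ext fun b ↦
          (congrArg u (add_mul a c b)).trans (u.map_add _ _) }
  act_algebraMap {ξ} r := fun u : O.obj (d.T.obj ξ) →ₗ[O.obj ξ] M.obj ξ ↦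
    LinearMap.ext fun b ↦ (congrArg u (Algebra.smul_def r b).symm).trans (u.map_smul r b)
  res_act {ξ ξ'} f b u := hd.hom_ext f fun c ↦ by
    refine (hd.homRes_resT M f _ c).trans ?_
    refine (hd.homRes_resT M f u (b * c)).symm.trans ?_
    rw [resT_mul]
    rfl

variable {M}

lemma isLocFree_coind (hM : IsLocFree M) : IsLocFree (hd.coind M) where
  finite ξ :=
    have := hd.finite ξ
    have := hd.projective ξ
    have := hM.finite ξ
    Module.Finite.linearMap_of_projective
  projective ξ :=
    have := hd.finite ξ
    have := hd.projective ξ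
    have := hM.projective ξ
    Module.Projective.linearMap_of_projective
  baseChange {ξ _} f :=
    have := hd.finite ξ
    have := hd.projective ξ
    (hM.baseChange f).linearMap (hd.baseChange f) (r := hd.homRes M f) (hd.homRes_resT M f)

variable (M)

/-- The counit `u ↦ u 1` from the coinduced module. -/
def counit : hd.coind M ⟶ M :=
  homOfNatural (fun ξ ↦ LinearMap.applyₗ (1 : O.obj (d.T.obj ξ))) fun {ξ _} f u ↦ by
    have h := hd.homRes_resT M f u 1
    rw [resT_one] at h
    exact h

/-- A preimage of `m` is `b ↦ ρ b • m`. The retraction `ρ` need not be natural, as surjectivity is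
tested pointwise. -/
lemma epi_counit : Epi (hd.counit M) :=
  PresheafOfModules.epi_of_surjective fun ξ m ↦ by
    obtain ⟨ρ, hρ⟩ := hd.exists_retraction ξ
    exact ⟨ρ.smulRight m, (congrArg (· • m) hρ).trans (one_smul _ m)⟩

end IsFiniteLocallyFree

end CoverData

end Stk

/-! ### Direct images and the unit of the adjunction. -/

section

variable (R B N : Type*) [CommRing R] [CommRing B] [Algebra R B] [AddCommGroup N] [Module R N]
  [Module B N] [IsScalarTower R B N]

lemma Module.Projective.restrictScalars_of_finite [Module.Projective R B] [Module.Finite B N]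
    [Module.Projective B N] : Module.Projective R N := by
  obtain ⟨k, f, g, -, -, hfg⟩ := Module.Finite.exists_comp_eq_id_of_projective B N
  have : Module.Projective R (Fin k → B) :=
    Module.Projective.of_equiv ((DFinsupp.linearEquivFunOnFintype :
      (Π₀ _ : Fin k, B) ≃ₗ[R] (Fin k → B)))
  exact Module.Projective.of_split (g.restrictScalars R) (f.restrictScalars R)
    (LinearMap.ext fun n ↦ congr($hfg n))

end

namespace Stk

open OMod

variable {C : Type*} [Category* C] {O : Cᵒᵖ ⥤ CommRingCat.{u}}

namespace CoverData

variable (d : CoverData C)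

/-- The value of `O` at `T ξ` as an algebra over its value at the covering object. -/
@[reducible] def algebraInl (ξ : Cᵒᵖ) : Algebra (O.obj d.pt) (O.obj (d.T.obj ξ)) :=
  (O.map (d.inl ξ)).hom.toAlgebra

attribute [local instance] algebraInl

lemma algebraMap_inl (ξ : Cᵒᵖ) (a : O.obj d.pt) :
    algebraMap (O.obj d.pt) (O.obj (d.T.obj ξ)) a = (O.map (d.inl ξ)).hom a := rfl

lemma resT_algebraMap_inl {ξ ξ' : Cᵒᵖ} (f : ξ ⟶ ξ') (a : O.obj d.pt) :
    d.resT f ((O.map (d.inl ξ)).hom a) = (O.map (d.inl ξ')).hom a := by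
  change (O.map (d.inl ξ) ≫ O.map (d.T.map f)).hom a = _
  rw [← O.map_comp, inl_map]

/-- The module `N` is the direct image of the module `P` on the covering object: its value at
`ξ` is the tensor product of `O(T ξ)` with `P`. -/
structure IsPushforward (P : Type u) [AddCommGroup P] [Module (O.obj d.pt) P] (N : OMod O) where
  /-- the identification of the values of `N` -/
  e (ξ : Cᵒᵖ) : O.obj (d.T.obj ξ) ⊗[O.obj d.pt] P ≃+ N.obj ξ
  e_smul (ξ : Cᵒᵖ) (r : O.obj ξ) (b : O.obj (d.T.obj ξ)) (p : P) :
    e ξ ((r • b) ⊗ₜ p) = r • e ξ (b ⊗ₜ p)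
  res_e {ξ ξ' : Cᵒᵖ} (f : ξ ⟶ ξ') (b : O.obj (d.T.obj ξ)) (p : P) :
    N.res f (e ξ (b ⊗ₜ p)) = e ξ' (d.resT f b ⊗ₜ p)

namespace IsPushforward

variable {d} {P : Type u} [AddCommGroup P] [Module (O.obj d.pt) P] {N : OMod O}
  (D : d.IsPushforward P N)

include D in
@[elab_as_elim]
lemma induction {ξ : Cᵒᵖ} {motive : N.obj ξ → Prop} (zero : motive 0)
    (add : ∀ a b, motive a → motive b → motive (a + b))
    (tmul : ∀ b p, motive (D.e ξ (b ⊗ₜ p))) (n : N.obj ξ) : motive n := by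
  obtain ⟨t, rfl⟩ := (D.e ξ).surjective n
  induction t using TensorProduct.induction_on with
  | zero => rwa [map_zero]
  | tmul b p => exact tmul b p
  | add a b ha hb => rw [map_add]; exact add _ _ ha hb

/-- Multiplication by an element of `O(T ξ)` on a direct image. -/
def mul {ξ : Cᵒᵖ} (b : O.obj (d.T.obj ξ)) : N.obj ξ →+ N.obj ξ :=
  (D.e ξ).toAddMonoidHom.comp
    ((DistribSMul.toAddMonoidHom _ b).comp (D.e ξ).symm.toAddMonoidHom)

lemma mul_apply {ξ : Cᵒᵖ} (b : O.obj (d.T.obj ξ)) (n : N.obj ξ) :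
    D.mul b n = D.e ξ (b • (D.e ξ).symm n) := rfl

lemma mul_e {ξ : Cᵒᵖ} (b c : O.obj (d.T.obj ξ)) (p : P) :
    D.mul b (D.e ξ (c ⊗ₜ p)) = D.e ξ ((b * c) ⊗ₜ p) := by
  rw [mul_apply, AddEquiv.symm_apply_apply, TensorProduct.smul_tmul', smul_eq_mul]

/-- The action on a direct image. -/
def action : d.Action N where
  act ξ :=
    { toFun := D.mul
      map_one' := AddMonoidHom.ext fun n ↦ by
        rw [mul_apply, one_smul, AddEquiv.apply_symm_apply]; rfl
      map_zero' := AddMonoidHom.ext fun n ↦ by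
        rw [mul_apply, zero_smul, map_zero]; rfl
      map_mul' := fun a b ↦ AddMonoidHom.ext fun n ↦ by
        change D.mul (a * b) n = D.mul a (D.mul b n)
        rw [mul_apply, mul_apply, mul_apply, AddEquiv.symm_apply_apply, mul_smul]
      map_add' := fun a b ↦ AddMonoidHom.ext fun n ↦ by
        change D.mul (a + b) n = D.mul a n + D.mul b n
        rw [mul_apply, mul_apply, mul_apply, add_smul, map_add] }
  act_algebraMap {ξ} r n := by
    change D.mul _ n = r • n
    induction n using D.induction with
    | zero => simp
    | add a b ha hb => rw [map_add, ha, hb, smul_add]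
    | tmul b p => rw [mul_e, ← Algebra.smul_def, D.e_smul]
  res_act {ξ ξ'} f b n := by
    change N.res f (D.mul b n) = D.mul (d.resT f b) (N.res f n)
    induction n using D.induction with
    | zero => simp
    | add a b ha hb => simp only [map_add, ha, hb]
    | tmul c p => rw [mul_e, D.res_e, D.res_e, mul_e, resT_mul]

lemma act_e {ξ : Cᵒᵖ} (b c : O.obj (d.T.obj ξ)) (p : P) :
    D.action.act ξ b (D.e ξ (c ⊗ₜ p)) = D.e ξ ((b * c) ⊗ₜ p) := D.mul_e b c p

variable (hd : d.IsFiniteLocallyFree O)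

include hd D

/-- Associativity of tensor products: `O(Tξ') ⊗ P` is `O(ξ') ⊗ (O(Tξ) ⊗ P)`, since `O(Tξ')` is the
base change of `O(Tξ)`. The inverse is built for each `p : P` and then assembled over the tensor
product. -/
lemma baseChange {ξ ξ' : Cᵒᵖ} (f : ξ ⟶ ξ') :
    IsBaseChangeAlong (O.map f).hom (N.res f) := by
  refine .of_leftInverse (fun n ↦ ?_) ?_
  · refine D.induction (Submodule.zero_mem _) (fun a b ha hb ↦ Submodule.add_mem _ ha hb)
      (fun b p ↦ ?_) n
    induction b using (hd.baseChange f).induction with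
    | zero => rw [TensorProduct.zero_tmul, map_zero]; exact Submodule.zero_mem _
    | add a b ha hb => rw [TensorProduct.add_tmul, map_add]; exact Submodule.add_mem _ ha hb
    | smul s b =>
      rw [D.e_smul, ← D.res_e]
      exact Submodule.smul_mem _ _ (Submodule.subset_span ⟨_, rfl⟩)
  · let := (O.map f).hom.toAlgebra
    have (p : P) : ∃ τ : O.obj (d.T.obj ξ') →+ O.obj ξ' ⊗[O.obj ξ] N.obj ξ,
        ∀ s b, τ (s • d.resT f b) = s ⊗ₜ D.e ξ (b ⊗ₜ p) :=
      (hd.baseChange f).exists_lift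
        (AddMonoidHom.mk' (fun s ↦ AddMonoidHom.mk'
          (fun b ↦ s ⊗ₜ[O.obj ξ] D.e ξ (b ⊗ₜ p)) fun b b' ↦ by
            rw [TensorProduct.add_tmul, map_add, TensorProduct.tmul_add])
          fun s s' ↦ AddMonoidHom.ext fun b ↦ TensorProduct.add_tmul _ _ _) fun s r b ↦ by
            change (s * (O.map f).hom r) ⊗ₜ[O.obj ξ] D.e ξ (b ⊗ₜ p) =
              s ⊗ₜ[O.obj ξ] D.e ξ ((r • b) ⊗ₜ p)
            rw [D.e_smul, ← TensorProduct.smul_tmul, Algebra.smul_def, mul_comm]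
            rfl
    choose τ hτ using this
    let t : O.obj (d.T.obj ξ') ⊗[O.obj d.pt] P →+ O.obj ξ' ⊗[O.obj ξ] N.obj ξ :=
      TensorProduct.liftAddHom (AddMonoidHom.flip (AddMonoidHom.mk' τ fun p p' ↦
          (hd.baseChange f).addHom_ext fun s b ↦ by
            rw [AddMonoidHom.add_apply, hτ, hτ, hτ, TensorProduct.tmul_add, map_add,
              TensorProduct.tmul_add])) fun a b p ↦ by
        change τ p (a • b) = τ (a • p) b
        induction b using (hd.baseChange f).induction with
        | zero => simp
        | add b b' hb hb' => rw [smul_add, map_add, map_add, hb, hb']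
        | smul s b =>
          -- Balancedness over `O(pt)`: restriction along `T.map f` is compatible with the structure
          -- maps from `O(pt)`, so the scalar `a` moves inside `resT` and then across to `p`.
          have : a • s • d.resT f b = s • d.resT f (a • b) := by
            rw [Algebra.smul_def a b, resT_mul, algebraMap_inl, resT_algebraMap_inl,
              Algebra.smul_def, Algebra.smul_def, Algebra.smul_def, algebraMap_inl]
            ring
          rw [this, hτ, hτ, TensorProduct.smul_tmul]
    refine ⟨t.comp (D.e ξ').symm.toAddMonoidHom, fun s n ↦ ?_⟩
    induction n using D.induction with
    | zero => simp
    | add a b ha hb => rw [map_add, smul_add, map_add, ha, hb, TensorProduct.tmul_add]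
    | tmul b p =>
      rw [D.res_e, ← D.e_smul]
      change t ((D.e ξ').symm _) = _
      rw [AddEquiv.symm_apply_apply]
      exact hτ p s b

/-- Finiteness and projectivity pass from `P` to `O(Tξ) ⊗ P` over `O(Tξ)`, and then down to `O(ξ)`
because `O(Tξ)` is itself finite projective there. -/
lemma isLocFree [Module.Finite (O.obj d.pt) P] [Module.Projective (O.obj d.pt) P] :
    IsLocFree N := by
  have key (ξ : Cᵒᵖ) : Module.Finite (O.obj ξ) (N.obj ξ) ∧
      Module.Projective (O.obj ξ) (N.obj ξ) := by
    let : Module (O.obj (d.T.obj ξ)) (N.obj ξ) := Module.compHom _ (D.action.act ξ)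
    have : IsScalarTower (O.obj ξ) (O.obj (d.T.obj ξ)) (N.obj ξ) :=
      .of_algebraMap_smul fun r n ↦ D.action.act_algebraMap r n
    let e : O.obj (d.T.obj ξ) ⊗[O.obj d.pt] P ≃ₗ[O.obj (d.T.obj ξ)] N.obj ξ :=
      { D.e ξ with
        map_smul' := fun b t ↦ by
          change D.e ξ (b • t) = D.e ξ (b • (D.e ξ).symm (D.e ξ t))
          rw [AddEquiv.symm_apply_apply] }
    have := Module.Finite.equiv e
    have := Module.Projective.of_equiv e
    have := hd.finite ξ
    have := hd.projective ξ
    exact ⟨Module.Finite.trans (O.obj (d.T.obj ξ)) _,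
      Module.Projective.restrictScalars_of_finite _ (O.obj (d.T.obj ξ)) _⟩
  exact ⟨fun ξ ↦ (key ξ).1, fun ξ ↦ (key ξ).2, D.baseChange hd⟩

end IsPushforward

section Unit

variable {d} {M N : OMod O} (D : d.IsPushforward (M.obj d.pt) N) (hM : IsLocFree M)

include hM in
lemma IsPushforward.exists_unit (ξ : Cᵒᵖ) : ∃ k : M.obj (d.T.obj ξ) →+ N.obj ξ,
    ∀ b x, k (b • M.res (d.inl ξ) x) = D.e ξ (b ⊗ₜ x) :=
  (hM.baseChange (d.inl ξ)).exists_lift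
    (AddMonoidHom.mk' (fun b ↦ AddMonoidHom.mk' (fun x ↦ D.e ξ (b ⊗ₜ x))
        fun x y ↦ by rw [TensorProduct.tmul_add, map_add])
      fun b c ↦ AddMonoidHom.ext fun x ↦
        (congrArg _ (TensorProduct.add_tmul b c x)).trans (map_add (D.e ξ) _ _))
    fun b a x ↦ by
      change D.e ξ ((b * _) ⊗ₜ[O.obj d.pt] x) = D.e ξ (b ⊗ₜ (a • x))
      rw [← TensorProduct.smul_tmul, Algebra.smul_def, mul_comm]
      rfl

/-- The identification of the value of `M` at `T ξ` with that of the direct image of its value at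
the covering object. -/
def IsPushforward.unitT (ξ : Cᵒᵖ) : M.obj (d.T.obj ξ) →+ N.obj ξ := (D.exists_unit hM ξ).choose

namespace IsPushforward

lemma unitT_smul_res {ξ : Cᵒᵖ} (b : O.obj (d.T.obj ξ)) (x : M.obj d.pt) :
    D.unitT hM ξ (b • M.res (d.inl ξ) x) = D.e ξ (b ⊗ₜ x) :=
  (D.exists_unit hM ξ).choose_spec b x

lemma unitT_smul {ξ : Cᵒᵖ} (b : O.obj (d.T.obj ξ)) (x : M.obj (d.T.obj ξ)) :
    D.unitT hM ξ (b • x) = D.action.act ξ b (D.unitT hM ξ x) := by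
  induction x using (hM.baseChange (d.inl ξ)).induction with
  | zero => simp
  | add a b ha hb => simp only [smul_add, map_add, ha, hb]
  | smul s m => rw [smul_smul, unitT_smul_res, unitT_smul_res, act_e]

lemma res_unitT {ξ ξ' : Cᵒᵖ} (f : ξ ⟶ ξ') (x : M.obj (d.T.obj ξ)) :
    N.res f (D.unitT hM ξ x) = D.unitT hM ξ' (M.res (d.T.map f) x) := by
  induction x using (hM.baseChange (d.inl ξ)).induction with
  | zero => simp
  | add a b ha hb => simp only [map_add, ha, hb]
  | smul s m =>
    rw [unitT_smul_res, res_e, res_smul, ← res_comp, M.res_congr (d.inl_map f), unitT_smul_res]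
    rfl

/-- The morphism from a locally free module to the direct image of its value at the covering
object. -/
def unit : M ⟶ N :=
  homOfNatural (fun ξ ↦
    { toFun := fun m ↦ D.unitT hM ξ (M.res (d.inr ξ) m)
      map_add' := by simp
      map_smul' := fun r m ↦ by
        rw [res_smul, unitT_smul]
        exact D.action.act_algebraMap _ _ }) fun {ξ ξ'} f m ↦ by
    change D.unitT hM ξ' _ = N.res f (D.unitT hM ξ _)
    rw [res_unitT, ← res_comp, ← res_comp, M.res_congr (d.inr_map f)]

/-- Identify `N(ξ)` with `M(Tξ) = O(Tξ) ⊗ M(ξ)` and apply `ρ ⊗ id`. A splitting at each point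
suffices to make the cokernel projective at each point. -/
lemma exists_retraction_unit (hd : d.IsFiniteLocallyFree O) (ξ : Cᵒᵖ) :
    ∃ l : N.obj ξ →ₗ[O.obj ξ] M.obj ξ, l ∘ₗ appₗ (D.unit hM) ξ = LinearMap.id := by
  obtain ⟨ρ, hρ⟩ := hd.exists_retraction ξ
  obtain ⟨r, hr⟩ := (hM.baseChange (d.inr ξ)).exists_lift (Q := M.obj ξ)
    (AddMonoidHom.mk' (fun b ↦ AddMonoidHom.mk' (fun x ↦ ρ b • x) fun x y ↦ smul_add _ _ _)
      fun b c ↦ AddMonoidHom.ext fun x ↦ by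
        change ρ (b + c) • x = ρ b • x + ρ c • x
        rw [map_add, add_smul])
    fun b a x ↦ by
      change ρ (b * algebraMap (O.obj ξ) (O.obj (d.T.obj ξ)) a) • x = ρ b • a • x
      rw [mul_comm, ← Algebra.smul_def, map_smul, smul_eq_mul, mul_comm, mul_smul]
  replace hr : ∀ b x, r (b • M.res (d.inr ξ) x) = ρ b • x := hr
  have r_smul (a : O.obj ξ) (u) :
      r (algebraMap (O.obj ξ) (O.obj (d.T.obj ξ)) a • u) = a • r u := by
    induction u using (hM.baseChange (d.inr ξ)).induction with
    | zero => simp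
    | add a b ha hb => simp only [smul_add, map_add, ha, hb]
    | smul s m => rw [smul_smul, hr, hr, ← Algebra.smul_def, map_smul, smul_eq_mul, mul_smul]
  -- A left inverse of `unitT`, read through `D.e`; it is the canonical map from the tensor product.
  let w : O.obj (d.T.obj ξ) ⊗[O.obj d.pt] M.obj d.pt →+ M.obj (d.T.obj ξ) :=
    TensorProduct.liftAddHom (AddMonoidHom.mk' (fun b ↦ AddMonoidHom.mk'
        (fun x ↦ b • M.res (d.inl ξ) x) fun x y ↦ by rw [map_add, smul_add])
      fun b c ↦ AddMonoidHom.ext fun x ↦ add_smul _ _ _) fun a b x ↦ by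
        change (a • b) • M.res (d.inl ξ) x = b • M.res (d.inl ξ) (a • x)
        rw [res_smul, smul_smul, Algebra.smul_def, mul_comm]
        rfl
  have w_tmul (b x) : w (b ⊗ₜ x) = b • M.res (d.inl ξ) x := rfl
  have w_unit (u) : w ((D.e ξ).symm (D.unitT hM ξ u)) = u := by
    induction u using (hM.baseChange (d.inl ξ)).induction with
    | zero => simp
    | add a b ha hb => simp only [map_add, ha, hb]
    | smul s m => rw [unitT_smul_res, AddEquiv.symm_apply_apply, w_tmul]
  refine ⟨{ toFun := fun n ↦ r (w ((D.e ξ).symm n))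
            map_add' := by simp
            map_smul' := fun a n ↦ ?_ }, LinearMap.ext fun m ↦ ?_⟩
  · change _ = a • r _
    rw [← r_smul]
    congr 1
    induction n using D.induction with
    | zero => simp
    | add b c hb hc => simp only [smul_add, map_add, hb, hc]
    | tmul b p =>
      rw [← D.e_smul, AddEquiv.symm_apply_apply, AddEquiv.symm_apply_apply, w_tmul, w_tmul,
        Algebra.smul_def, mul_smul]
  · change r (w ((D.e ξ).symm (D.unitT hM ξ (M.res (d.inr ξ) m)))) = m
    rw [w_unit]
    simpa [hρ] using hr 1 m

lemma mono_unit (hd : d.IsFiniteLocallyFree O) : Mono (D.unit hM) :=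
  PresheafOfModules.mono_of_injective fun ξ ↦ by
    obtain ⟨l, hl⟩ := D.exists_retraction_unit hM hd ξ
    exact LinearMap.injective_of_comp_eq_id _ _ hl

lemma isLocFree_cokernel_unit (hd : d.IsFiniteLocallyFree O) :
    IsLocFree (cokernel (D.unit hM)) := by
  have := D.mono_unit hM hd
  have hS := ExactStr.shortExact_cokernel (D.unit hM)
  have := hM.finite d.pt
  have := hM.projective d.pt
  have hN : IsLocFree N := D.isLocFree hd
  refine IsLocFree.X₃ hS hM hN fun ξ ↦ ?_
  have ⟨_, s, hs⟩ := ((Function.Exact.split_tfae' (exact_appₗ hS ξ)).out 0 1 :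
    (Function.Injective (appₗ (D.unit hM) ξ) ∧
        ∃ l, appₗ (cokernel.π (D.unit hM)) ξ ∘ₗ l = LinearMap.id) ↔
      (Function.Surjective (appₗ (cokernel.π (D.unit hM)) ξ) ∧
        ∃ l, l ∘ₗ appₗ (D.unit hM) ξ = LinearMap.id)).2
          ⟨surjective_appₗ hS ξ, D.exists_retraction_unit hM hd ξ⟩
  have := hN.projective ξ
  exact Module.Projective.of_split s _ hs

end IsPushforward

end Unit

end CoverData

end Stk

/-! ### Retractions of faithfully flat algebras, and pushouts of rings. -/

/-- A faithfully flat algebra that is finite and projective as a module admits a linear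
retraction onto the base ring. -/
lemma Module.FaithfullyFlat.exists_retraction (A B : Type*) [CommRing A] [CommRing B] [Algebra A B]
    [Module.Finite A B] [Module.Projective A B] [Module.FaithfullyFlat A B] :
    ∃ ρ : B →ₗ[A] A, ρ 1 = 1 := by
  -- The ideal of all values `ρ 1`. If it lay in a maximal ideal `m`, expanding `1` in a dual basis
  -- would give `m B = B`, against faithful flatness.
  let I : Ideal A := LinearMap.range (LinearMap.applyₗ (1 : B) : (B →ₗ[A] A) →ₗ[A] A)
  suffices h : I = ⊤ by
    obtain ⟨ρ, hρ⟩ := (Ideal.eq_top_iff_one I).1 h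
    exact ⟨ρ, hρ⟩
  by_contra hI
  obtain ⟨m, hm, hIm⟩ := Ideal.exists_le_maximal I hI
  refine Module.FaithfullyFlat.submodule_ne_top (M := B) hm (eq_top_iff.2 fun b _ ↦ ?_)
  obtain ⟨k, φ, e, he⟩ := Module.exists_dualBasis A B
  rw [← mul_one b, ← he 1, Finset.mul_sum]
  refine Submodule.sum_mem _ fun i _ ↦ ?_
  rw [mul_smul_comm]
  exact Submodule.smul_mem_smul (hIm ⟨φ i, rfl⟩) trivial

lemma Stk.IsBaseChangeAlong.of_isPushout {R S R' S' : CommRingCat.{u}} {f : R ⟶ R'} {g : R ⟶ S}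
    {a : R' ⟶ S'} {b : S ⟶ S'} (h : IsPushout f g a b)
    (β : letI := g.hom.toAlgebra; letI := a.hom.toAlgebra; S →ₛₗ[f.hom] S')
    (hβ : ∀ x, β x = b.hom x) :
    letI := g.hom.toAlgebra; letI := a.hom.toAlgebra; IsBaseChangeAlong f.hom β := by
  let := f.hom.toAlgebra
  let := g.hom.toAlgebra
  let := a.hom.toAlgebra
  let := b.hom.toAlgebra
  let := (f ≫ a).hom.toAlgebra
  have : IsScalarTower R R' S' := .of_algebraMap_eq fun _ ↦ rfl
  have : IsScalarTower R S S' := .of_algebraMap_eq fun x ↦ by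
    change (f ≫ a).hom x = (g ≫ b).hom x
    rw [h.w]
  have h' : Algebra.IsPushout R R' S S' := CommRingCat.isPushout_iff_isPushout.1 h
  let e := Algebra.IsPushout.equiv R R' S S'
  have he (s m) : e (s ⊗ₜ m) = s • β m := by
    rw [hβ, Algebra.IsPushout.equiv_tmul, Algebra.smul_def]
    rfl
  refine .of_leftInverse (fun n ↦ ?_) ⟨e.symm.toAddMonoidHom, fun s m ↦ ?_⟩
  · obtain ⟨t, rfl⟩ := e.surjective n
    induction t using TensorProduct.induction_on with
    | zero => rw [map_zero]; exact Submodule.zero_mem _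
    | tmul s m => rw [he]; exact Submodule.smul_mem _ _ (Submodule.subset_span ⟨m, rfl⟩)
    | add x y hx hy => rw [map_add]; exact Submodule.add_mem _ hx hy
  · rw [← he]
    exact e.symm_apply_apply _

/-! ### Cartesian arrows in a category fibered in groupoids. -/

namespace Stk

open Functor

section Cartesian

variable {F : Pseudofunctor (LocallyDiscrete Scheme.{u}ᵒᵖ) Cat.{v', u'}}

/-- An arrow over an identity lives in a fibre, and the fibre is equivalent to the groupoid `F(S)`.
-/
lemma isIso_of_isHomLift_id (hF : ∀ T, IsGroupoid (F.obj T))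
    {ξ' ξ : Pseudofunctor.CoGrothendieck F} (S : Scheme.{u}) (χ : ξ' ⟶ ξ)
    [IsHomLift (Pseudofunctor.CoGrothendieck.forget F) (𝟙 S) χ] : IsIso χ := by
  have := hF ⟨op S⟩
  let e := Fiber.inducedFunctor (Pseudofunctor.CoGrothendieck.comp_const F S)
  let χ' := Fiber.homMk (Pseudofunctor.CoGrothendieck.forget F) S χ
  have : IsIso (e.inv.map χ') := IsGroupoid.all_isIso _
  have : IsIso χ' := isIso_of_reflects_iso χ' e.inv
  exact inferInstanceAs (IsIso (Fiber.fiberInclusion.map χ'))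

/-- Any arrow factors through the chosen cartesian lift by a vertical arrow, which is invertible. -/
lemma isStronglyCartesian_of_isGroupoid (hF : ∀ T, IsGroupoid (F.obj T))
    {ξ' ξ : Pseudofunctor.CoGrothendieck F} (φ : ξ' ⟶ ξ) :
    IsStronglyCartesian (Pseudofunctor.CoGrothendieck.forget F) φ.base φ := by
  let p := Pseudofunctor.CoGrothendieck.forget F
  let κ := Pseudofunctor.CoGrothendieck.cartesianLift ξ.fiber φ.base
  have : IsStronglyCartesian p φ.base κ :=
    Pseudofunctor.CoGrothendieck.isStronglyCartesian_homCartesianLift ξ.fiber φ.base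
  have : IsHomLift p φ.base φ := IsHomLift.map p φ
  let χ : ξ' ⟶ _ := IsStronglyCartesian.map p φ.base κ (Category.id_comp φ.base).symm φ
  have : IsIso χ := isIso_of_isHomLift_id hF ξ'.base χ
  have : IsStronglyCartesian p (𝟙 ξ'.base) χ := IsStronglyCartesian.of_isIso p _ χ
  have h : IsStronglyCartesian p (𝟙 ξ'.base ≫ φ.base) (χ ≫ κ) := IsStronglyCartesian.comp p
  rwa [Category.id_comp, IsStronglyCartesian.fac] at h

lemma exists_hom_of_isGroupoid (hF : ∀ T, IsGroupoid (F.obj T))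
    {η ξ' ξ : Pseudofunctor.CoGrothendieck F} (φ : ξ' ⟶ ξ) (g : η ⟶ ξ) (h : η.base ⟶ ξ'.base)
    (w : g.base = h ≫ φ.base) : ∃ χ : η ⟶ ξ', χ.base = h ∧ χ ≫ φ = g := by
  have := isStronglyCartesian_of_isGroupoid hF φ
  have : IsHomLift (Pseudofunctor.CoGrothendieck.forget F) g.base g := IsHomLift.map _ g
  refine ⟨IsStronglyCartesian.map (Pseudofunctor.CoGrothendieck.forget F) φ.base φ w g, ?_,
    IsStronglyCartesian.fac _ _ _ _ _⟩
  exact (IsHomLift.fac (Pseudofunctor.CoGrothendieck.forget F) h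
    (IsStronglyCartesian.map (Pseudofunctor.CoGrothendieck.forget F) φ.base φ w g)).symm.trans
      (by simp)

lemma hom_ext_of_isGroupoid (hF : ∀ T, IsGroupoid (F.obj T))
    {η ξ' ξ : Pseudofunctor.CoGrothendieck F} (φ : ξ' ⟶ ξ) {χ χ' : η ⟶ ξ'}
    (w : χ.base = χ'.base) (h : χ ≫ φ = χ' ≫ φ) : χ = χ' := by
  have := isStronglyCartesian_of_isGroupoid hF φ
  have : IsHomLift (Pseudofunctor.CoGrothendieck.forget F) χ.base χ := IsHomLift.map _ χ
  have : IsHomLift (Pseudofunctor.CoGrothendieck.forget F) χ.base χ' := w ▸ IsHomLift.map _ χ'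
  exact IsStronglyCartesian.ext (Pseudofunctor.CoGrothendieck.forget F) φ.base φ χ.base h

namespace AffineCover

variable (c : AffineCover F)

lemma exists_prod_lift {η ξ : Pseudofunctor.CoGrothendieck F} (a : η ⟶ c.pt) (b : η ⟶ ξ) :
    ∃ l : η ⟶ c.prod ξ, l ≫ c.fst ξ = a ∧ l ≫ c.snd ξ = b :=
  ⟨(c.isLimit ξ).lift (BinaryFan.mk a b), (c.isLimit ξ).fac (BinaryFan.mk a b) ⟨.left⟩,
    (c.isLimit ξ).fac (BinaryFan.mk a b) ⟨.right⟩⟩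

/-- Products in the fibered category become fibre products of schemes: a test scheme over the
product at `ξ` acquires a point of `F` by pullback, and morphisms of schemes from it then lift
uniquely along cartesian arrows. -/
lemma isPullback_base (hF : ∀ T, IsGroupoid (F.obj T)) {ξ' ξ : Pseudofunctor.CoGrothendieck F}
    (f : ξ' ⟶ ξ) :
    IsPullback (c.prodMap f).base (c.snd ξ').base (c.snd ξ).base f.base := by
  have w : (c.prodMap f).base ≫ (c.snd ξ).base = (c.snd ξ').base ≫ f.base :=
    congr_arg (Pseudofunctor.CoGrothendieck.forget F).map (c.prodMap_snd f)
  have hex {S : Scheme.{u}} (a : S ⟶ (c.prod ξ).base) (b : S ⟶ ξ'.base)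
      (hab : a ≫ (c.snd ξ).base = b ≫ f.base) :
      ∃ l : S ⟶ (c.prod ξ').base, l ≫ (c.prodMap f).base = a ∧ l ≫ (c.snd ξ').base = b := by
    let α := Pseudofunctor.CoGrothendieck.cartesianLift (c.prod ξ).fiber a
    obtain ⟨β, rfl, hβ⟩ := exists_hom_of_isGroupoid hF f (α ≫ c.snd ξ) b hab
    obtain ⟨γ, h₁, h₂⟩ := c.exists_prod_lift (α ≫ c.fst ξ) β
    have h₃ : γ ≫ c.prodMap f = α := c.prod_hom_ext
      (by rw [Category.assoc, prodMap_fst, h₁])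
      (by rw [Category.assoc, prodMap_snd, reassoc_of% h₂, hβ])
    exact ⟨γ.base, congr_arg (Pseudofunctor.CoGrothendieck.forget F).map h₃,
      congr_arg (Pseudofunctor.CoGrothendieck.forget F).map h₂⟩
  have huniq {S : Scheme.{u}} (m m' : S ⟶ (c.prod ξ').base)
      (h₁ : m ≫ (c.prodMap f).base = m' ≫ (c.prodMap f).base)
      (h₂ : m ≫ (c.snd ξ').base = m' ≫ (c.snd ξ').base) : m = m' := by
    let α := Pseudofunctor.CoGrothendieck.cartesianLift (c.prod ξ).fiber (m ≫ (c.prodMap f).base)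
    obtain ⟨μ, hm, hμ⟩ := exists_hom_of_isGroupoid hF (c.prodMap f) α m rfl
    obtain ⟨μ', hm', hμ'⟩ := exists_hom_of_isGroupoid hF (c.prodMap f) α m' h₁
    have : μ = μ' := c.prod_hom_ext
      (by rw [← c.prodMap_fst f, reassoc_of% hμ, reassoc_of% hμ'])
      (hom_ext_of_isGroupoid hF f
        (show μ.base ≫ (c.snd ξ').base = μ'.base ≫ (c.snd ξ').base by rw [hm, hm', h₂]) (by
        rw [Category.assoc, Category.assoc, ← prodMap_snd, reassoc_of% hμ, reassoc_of% hμ']))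
    rw [← hm, ← hm', this]
  exact ⟨⟨w⟩, ⟨PullbackCone.IsLimit.mk w (fun s ↦ (hex s.fst s.snd s.condition).choose)
    (fun s ↦ (hex s.fst s.snd s.condition).choose_spec.1)
    (fun s ↦ (hex s.fst s.snd s.condition).choose_spec.2)
    fun s m h₁ h₂ ↦ huniq _ _ (h₁.trans (hex s.fst s.snd s.condition).choose_spec.1.symm)
      (h₂.trans (hex s.fst s.snd s.condition).choose_spec.2.symm)⟩⟩

end AffineCover

end Cartesian

end Stk

/-! ### The cover of the affine points, and passage to locally free modules on the stack. -/

namespace Stk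

open OMod

variable {F : Pseudofunctor (LocallyDiscrete Scheme.{u}ᵒᵖ) Cat.{v', u'}}

namespace AffineCover

variable (c : AffineCover F)

lemma isAffine_prod (ξ : Pseudofunctor.CoGrothendieck F) [IsAffine ξ.base] :
    IsAffine (c.prod ξ).base :=
  have := c.isFinite ξ
  isAffine_of_isAffineHom (c.snd ξ).base

/-- The cover of the category of affine points given by an affine cover of a stack. -/
def coverData : CoverData (AffPt F) where
  pt := op ⟨c.pt, c.isAffine⟩
  T :=
    { obj := fun ξ ↦ op ⟨c.prod ξ.unop.obj, have := ξ.unop.property; c.isAffine_prod _⟩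
      map := fun f ↦ Quiver.Hom.op (ObjectProperty.homMk (c.prodMap f.unop.hom))
      map_id := fun _ ↦ Quiver.Hom.unop_inj (ObjectProperty.hom_ext _ (c.prodMap_id _))
      map_comp := fun _ _ ↦ Quiver.Hom.unop_inj (ObjectProperty.hom_ext _ (c.prodMap_comp _ _)) }
  inl ξ := Quiver.Hom.op (ObjectProperty.homMk (c.fst ξ.unop.obj))
  inr ξ := Quiver.Hom.op (ObjectProperty.homMk (c.snd ξ.unop.obj))
  inl_map _ := Quiver.Hom.unop_inj (ObjectProperty.hom_ext _ (c.prodMap_fst _))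
  inr_map _ := Quiver.Hom.unop_inj (ObjectProperty.hom_ext _ (c.prodMap_snd _))

lemma finite_coverData (ξ : (AffPt F)ᵒᵖ) : Module.Finite ((structureSheaf F).obj ξ)
    ((structureSheaf F).obj (c.coverData.T.obj ξ)) := by
  have := ξ.unop.property
  have := c.isFinite ξ.unop.obj
  exact Scheme.Hom.finite_appTop (c.snd ξ.unop.obj).base

lemma faithfullyFlat_coverData (ξ : (AffPt F)ᵒᵖ) :
    Module.FaithfullyFlat ((structureSheaf F).obj ξ)
      ((structureSheaf F).obj (c.coverData.T.obj ξ)) := by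
  have := ξ.unop.property
  have := c.isAffine_prod ξ.unop.obj
  exact (Flat.flat_and_surjective_iff_faithfullyFlat_of_isAffine (c.snd ξ.unop.obj).base).1
    ⟨c.flat _, c.surjective _⟩

/-- A finite algebra of finite presentation is finitely presented as a module, and flat modules of
finite presentation are projective. -/
lemma projective_coverData (ξ : (AffPt F)ᵒᵖ) : Module.Projective ((structureSheaf F).obj ξ)
    ((structureSheaf F).obj (c.coverData.T.obj ξ)) := by
  have := ξ.unop.property
  have := c.isAffine_prod ξ.unop.obj
  have := c.locallyOfFinitePresentation ξ.unop.obj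
  have := c.finite_coverData ξ
  have := c.faithfullyFlat_coverData ξ
  have : Algebra.FinitePresentation ((structureSheaf F).obj ξ)
      ((structureSheaf F).obj (c.coverData.T.obj ξ)) :=
    Scheme.Hom.finitePresentation_appTop (c.snd ξ.unop.obj).base
  have : Module.FinitePresentation ((structureSheaf F).obj ξ)
      ((structureSheaf F).obj (c.coverData.T.obj ξ)) :=
    .of_finite_of_finitePresentation _ _
  exact Module.Flat.projective_of_finitePresentation

lemma isFiniteLocallyFree (hF : ∀ T, IsGroupoid (F.obj T)) :
    c.coverData.IsFiniteLocallyFree (structureSheaf F) where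
  finite := c.finite_coverData
  projective := c.projective_coverData
  baseChange {ξ ξ'} f := by
    have : IsAffine ξ.unop.obj.base := ξ.unop.property
    have : IsAffine ξ'.unop.obj.base := ξ'.unop.property
    have := c.isAffine_prod ξ.unop.obj
    have h := isPushout_appTop_of_isPullback (c.isPullback_base hF f.unop.hom).flip
    have h' : IsPushout ((structureSheaf F).map f) ((structureSheaf F).map (c.coverData.inr ξ))
        ((structureSheaf F).map (c.coverData.inr ξ'))
        ((structureSheaf F).map (c.coverData.T.map f)) := h
    exact IsBaseChangeAlong.of_isPushout h' (c.coverData.resT f) fun _ ↦ rfl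
  exists_retraction ξ :=
    have := c.finite_coverData ξ
    have := c.projective_coverData ξ
    have := c.faithfullyFlat_coverData ξ
    Module.FaithfullyFlat.exists_retraction _ _

/-- The direct image of a module along an affine cover is a direct image with respect to the
corresponding cover of the category of affine points. -/
def isPushforward (P : Type u) [AddCommGroup P] [inst : Module (Γpt c.pt) P] :
    @CoverData.IsPushforward _ _ (structureSheaf F) c.coverData P _ inst (c.pushforward P) :=
  let : Module ((structureSheaf F).obj c.coverData.pt) P := inst
  { e := fun ξ ↦ AddEquiv.refl (c.PushObj P ξ.unop.obj)
    e_smul := fun _ _ _ _ ↦ rfl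
    res_e := fun _ _ _ ↦ rfl }

end AffineCover

lemma isLocallyFree_eq : IsLocallyFree (F := F) = IsLocFree (O := structureSheaf F) :=
  funext fun _ ↦ propext ⟨fun h ↦ ⟨h.finite, h.projective, h.baseChange⟩,
    fun h ↦ ⟨h.finite, h.projective, h.baseChange⟩⟩

instance : ObjectProperty.IsClosedUnderExtensions (IsLocallyFree (F := F)) :=
  isLocallyFree_eq (F := F) ▸ inferInstance

instance : ObjectProperty.ContainsZero (IsLocallyFree (F := F)) :=
  isLocallyFree_eq (F := F) ▸ inferInstance

instance : ObjectProperty.IsClosedUnderIsomorphisms (IsLocallyFree (F := F)) :=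
  isLocallyFree_eq (F := F) ▸ inferInstance

lemma isExactCategory_conflations : ExactStr.IsExactCategory (conflations F) :=
  ExactStr.isExactCategory_shortExactIn (P := IsLocallyFree (F := F))

lemma IsLocallyFree.isLocFree {M : PMod F} (h : IsLocallyFree M) :
    IsLocFree (O := structureSheaf F) M :=
  isLocallyFree_eq (F := F) ▸ h

lemma IsLocFree.isLocallyFree {M : PMod F} (h : IsLocFree (O := structureSheaf F) M) :
    IsLocallyFree M :=
  isLocallyFree_eq (F := F) ▸ h

variable {d : CoverData (AffPt F)}

namespace CoverData

lemma Action.isInjective {N : LF F} (A : d.Action (O := structureSheaf F) N.obj) :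
    ExactStr.IsInjective (conflations F) N := by
  rintro X Y f ⟨Z, g, w, h⟩ k
  obtain ⟨l, hl⟩ := A.exists_extension h X.property.isLocFree Y.property.isLocFree
    Z.property.isLocFree k.hom
  exact ⟨ObjectProperty.homMk l, ObjectProperty.hom_ext _ hl⟩

lemma Action.isProjective {N : LF F} (A : d.Action (O := structureSheaf F) N.obj) :
    ExactStr.IsProjective (conflations F) N := by
  rintro Y Z g ⟨X, f, w, h⟩ k
  obtain ⟨l, hl⟩ := A.exists_lift N.property.isLocFree h Y.property.isLocFree
    Z.property.isLocFree k.hom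
  exact ⟨ObjectProperty.homMk l, ObjectProperty.hom_ext _ hl⟩

variable (hd : d.IsFiniteLocallyFree (structureSheaf F))

include hd

/-- The source is the coinduced module. Its injectivity is recorded as well, since it makes
projective objects injective. -/
lemma IsFiniteLocallyFree.exists_isDeflation (M : LF F) :
    ∃ (P : LF F) (g : P ⟶ M), ExactStr.IsProjective (conflations F) P ∧
      ExactStr.IsInjective (conflations F) P ∧ ExactStr.IsDeflation (conflations F) g := by
  have hM := M.property.isLocFree
  have h := hd.isLocFree_coind hM
  have := hd.epi_counit M.obj
  let P : LF F := ⟨hd.coind M.obj, h.isLocallyFree⟩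
  have A : d.Action (O := structureSheaf F) P.obj := hd.coindAction M.obj
  exact ⟨P, ObjectProperty.homMk (hd.counit M.obj), A.isProjective, A.isInjective,
    (ExactStr.isDeflation_iff (P := IsLocallyFree (F := F)) _).2 ⟨this,
      (IsLocFree.X₁ (ExactStr.shortExact_kernel (hd.counit M.obj)) h hM).isLocallyFree⟩⟩

lemma IsPushforward.isInflation_unit {M N : LF F}
    (D : d.IsPushforward (O := structureSheaf F) (M.obj.obj d.pt) N.obj) :
    ExactStr.IsInflation (conflations F)
      (ObjectProperty.homMk (D.unit M.property.isLocFree) : M ⟶ N) :=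
  (ExactStr.isInflation_iff (P := IsLocallyFree (F := F)) _).2
    ⟨D.mono_unit M.property.isLocFree hd,
      (D.isLocFree_cokernel_unit M.property.isLocFree hd).isLocallyFree⟩

end CoverData

end Stk

/-! ### Retracts and the Frobenius property. -/

namespace ExactStr

variable {C : Type u} [Category.{v} C] [Preadditive C] {E : ObjectProperty (ShortComplex C)}

lemma IsProjective.of_retract {P Q : C} (h : IsProjective E P) (i : Q ⟶ P) (r : P ⟶ Q)
    (w : i ≫ r = 𝟙 Q) : IsProjective E Q := fun Y Z g hg k ↦ by
  obtain ⟨l, hl⟩ := h g hg (r ≫ k)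
  exact ⟨i ≫ l, by rw [Category.assoc, hl, reassoc_of% w]⟩

lemma IsInjective.of_retract {I Q : C} (h : IsInjective E I) (i : Q ⟶ I) (r : I ⟶ Q)
    (w : i ≫ r = 𝟙 Q) : IsInjective E Q := fun X Y f hf k ↦ by
  obtain ⟨l, hl⟩ := h f hf (k ≫ i)
  exact ⟨l ≫ r, by rw [reassoc_of% hl, w, Category.comp_id]⟩

end ExactStr

namespace Stk

variable {F : Pseudofunctor (LocallyDiscrete Scheme.{u}ᵒᵖ) Cat.{v', u'}}
  (hF : ∀ T, IsGroupoid (F.obj T)) (c : AffineCover F)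

namespace AffineCover

include hF in
lemma isLocallyFree_pushforward (P : Type u) [AddCommGroup P] [inst : Module (Γpt c.pt) P]
    [hfin : Module.Finite (Γpt c.pt) P] [hproj : Module.Projective (Γpt c.pt) P] :
    IsLocallyFree (c.pushforward P) := by
  let : Module ((structureSheaf F).obj c.coverData.pt) P := inst
  have : Module.Finite ((structureSheaf F).obj c.coverData.pt) P := hfin
  have : Module.Projective ((structureSheaf F).obj c.coverData.pt) P := hproj
  exact ((c.isPushforward P).isLocFree (c.isFiniteLocallyFree hF)).isLocallyFree

lemma isProjective_of_pushforward {P : Type u} [AddCommGroup P] [inst : Module (Γpt c.pt) P]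
    {N : LF F} (e : N.obj ≅ c.pushforward P) : ExactStr.IsProjective (conflations F) N := by
  let : Module ((structureSheaf F).obj c.coverData.pt) P := inst
  have h : IsLocallyFree (c.pushforward P) :=
    ObjectProperty.prop_of_iso (IsLocallyFree (F := F)) e N.property
  let N' : LF F := ⟨c.pushforward P, h⟩
  have A : c.coverData.Action (O := structureSheaf F) N'.obj := (c.isPushforward P).action
  exact A.isProjective.of_retract (ObjectProperty.homMk e.hom) (ObjectProperty.homMk e.inv)
    (ObjectProperty.hom_ext _ e.hom_inv_id)

/-- The sections of a module over a stack on the affine scheme of a cover. -/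
abbrev sections (M : PMod F) : Type u := M.obj c.coverData.pt

instance (M : PMod F) : Module (Γpt c.pt) (c.sections M) :=
  inferInstanceAs (Module ((structureSheaf F).obj c.coverData.pt) (M.obj c.coverData.pt))

include hF in
lemma exists_isInflation (M : LF F) : ∃ (h : IsLocallyFree (c.pushforward (c.sections M.obj)))
    (f : M ⟶ ⟨c.pushforward (c.sections M.obj), h⟩), ExactStr.IsInflation (conflations F) f := by
  have : Module.Finite (Γpt c.pt) (c.sections M.obj) := M.property.finite c.coverData.pt
  have : Module.Projective (Γpt c.pt) (c.sections M.obj) := M.property.projective c.coverData.pt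
  have h := c.isLocallyFree_pushforward hF (c.sections M.obj)
  exact ⟨h, _, CoverData.IsPushforward.isInflation_unit (c.isFiniteLocallyFree hF)
    (N := ⟨c.pushforward (c.sections M.obj), h⟩) (c.isPushforward (c.sections M.obj))⟩

lemma isInjective_pushforward {P : Type u} [AddCommGroup P] [inst : Module (Γpt c.pt) P]
    (h : IsLocallyFree (c.pushforward P)) :
    ExactStr.IsInjective (conflations F) ⟨c.pushforward P, h⟩ := by
  let : Module ((structureSheaf F).obj c.coverData.pt) P := inst
  exact ((c.isPushforward P).action).isInjective (N := ⟨c.pushforward P, h⟩)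

include hF c in
theorem isFrobeniusCategory : ExactStr.IsFrobeniusCategory (conflations F) where
  exact := isExactCategory_conflations
  enoughProjectives M := by
    obtain ⟨P, g, hP, -, hg⟩ := (c.isFiniteLocallyFree hF).exists_isDeflation M
    exact ⟨P, g, hP, hg⟩
  enoughInjectives M := by
    obtain ⟨h, f, hf⟩ := c.exists_isInflation hF M
    exact ⟨_, f, c.isInjective_pushforward h, hf⟩
  projective_iff_injective M := by
    constructor
    · intro hM
      obtain ⟨P, g, -, hP, hg⟩ := (c.isFiniteLocallyFree hF).exists_isDeflation M
      -- Projectivity splits the deflation from the coinduced module, which is injective.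
      obtain ⟨l, hl⟩ := hM g hg (𝟙 M)
      exact hP.of_retract l g hl
    · intro hM
      obtain ⟨h, f, hf⟩ := c.exists_isInflation hF M
      -- Injectivity splits the inflation into the direct image, which is projective.
      obtain ⟨l, hl⟩ := hM f hf (𝟙 M)
      exact (c.isProjective_of_pushforward (N := ⟨_, h⟩) (Iso.refl _)).of_retract f l hl

-- The inflation of `M` into the direct image of its own sections on `Y` splits, and its cokernel
-- `M'`, being part of a conflation, is a complement in the category of locally free modules.
include hF in
lemma exists_biprod_iso_pushforward {M : LF F} (hM : ExactStr.IsInjective (conflations F) M) :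
    ∃ M' : LF F, Nonempty (M.obj ⊞ M'.obj ≅ c.pushforward (c.sections M.obj)) := by
  obtain ⟨h, f, hf⟩ := c.exists_isInflation hF M
  obtain ⟨l, hl⟩ := hM f hf (𝟙 M)
  obtain ⟨M', g, w, hS⟩ := hf
  exact ⟨M', ⟨((ShortComplex.Splitting.ofExactOfRetraction _ hS.exact l.hom
    (congrArg (·.hom) hl) hS.epi_g).isoBinaryBiproduct).symm⟩⟩

lemma isProjective_of_biprod_iso_pushforward {P : Type u} [AddCommGroup P]
    [Module (Γpt c.pt) P] {M M' : LF F} (e : M.obj ⊞ M'.obj ≅ c.pushforward P)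
    (h : IsLocallyFree (c.pushforward P)) :
    ExactStr.IsProjective (conflations F) M :=
  (c.isProjective_of_pushforward (N := ⟨_, h⟩) (Iso.refl _)).of_retract
    (ObjectProperty.homMk (biprod.inl ≫ e.hom)) (ObjectProperty.homMk (e.inv ≫ biprod.fst))
    (ObjectProperty.hom_ext _ (show (biprod.inl ≫ e.hom) ≫ e.inv ≫ biprod.fst = 𝟙 _ by simp))

end AffineCover

end Stk

end

theorem mainTheorem12
    (F : Pseudofunctor (LocallyDiscrete Scheme.{u}ᵒᵖ) Cat.{v', u'})
    (hF : Stk.IsWellNighAffine F) :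
    ExactStr.IsFrobeniusCategory (Stk.conflations F) ∧
    ∀ c : Stk.AffineCover F,
      (∀ (P : Type u) [AddCommGroup P] [Module (Scheme.Γ.obj (op c.pt.base)) P]
        [Module.Finite (Scheme.Γ.obj (op c.pt.base)) P]
        [Module.Projective (Scheme.Γ.obj (op c.pt.base)) P],
        Stk.IsLocallyFree (c.pushforward P)) ∧
      ∀ Q : Stk.LF F,
        ExactStr.IsProjective (Stk.conflations F) Q ↔
          ∃ (P : Type u) (_ : AddCommGroup P) (_ : Module (Scheme.Γ.obj (op c.pt.base)) P),
            Module.Finite (Scheme.Γ.obj (op c.pt.base)) P ∧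
            Module.Projective (Scheme.Γ.obj (op c.pt.base)) P ∧
            ∃ Q' : Stk.LF F, Nonempty (Q.obj ⊞ Q'.obj ≅ c.pushforward P) := by
  have hG := hF.isStack.isGroupoid
  obtain ⟨c₀⟩ := hF.exists_cover
  have hE := c₀.isFrobeniusCategory hG
  refine ⟨hE, fun c ↦ ⟨fun P ↦ c.isLocallyFree_pushforward hG P, fun Q ↦ ⟨fun hQ ↦ ?_, ?_⟩⟩⟩
  · exact ⟨c.sections Q.obj, inferInstance, inferInstance, Q.property.finite c.coverData.pt,
      Q.property.projective c.coverData.pt,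
      c.exists_biprod_iso_pushforward hG ((hE.projective_iff_injective Q).1 hQ)⟩
  · rintro ⟨P, _, _, _, _, Q', ⟨e⟩⟩
    exact c.isProjective_of_biprod_iso_pushforward e (c.isLocallyFree_pushforward hG P)
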